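/- Let $M$ be a finite von Neumann algebra with separable predual and with a faithful normal trace $\tau$, $\tau(1)=1$, standardly represented on $L^2(M,\tau)$; let $\xi\in L^2(M,\tau)$ be the vector given by $1\in M$, so that $\tau(x)=\langle x\xi,\xi\rangle$ for $x\in M$ and $M\xi$ is dense. Let $B\subseteq M$ be a von Neumann subalgebra with the same unit such that $B'\cap M\subseteq B$, and write $Z(B)=B'\cap B$. Let $e_B$ be the orthogonal projection of $L^2(M,\tau)$ onto the closure $L^2(B)$ of $B\xi$, let $\langle M,e_B\rangle$ be the von Neumann algebra generated by $M$ and $e_B$, and let $\mathrm{Tr}$ be its canonical trace, that is, the unique faithful normal semifinite trace on $\langle M,e_B\rangle$ with $\mathrm{Tr}(xe_By)=\tau(xy)$ for all $x,y\in M$. An intertwiner of $B$ is a partial isometry $v\in M$ with $vBv^*\subseteq B$ and $v^*v\in B$; the set of intertwiners is denoted $\mathcal{GN}^{(1)}(B)$. Let $q\in B$ be a projection, and let $P$ be a projection in $(B'\cap\langle M,e_B\rangle)q=\{xq: x\in B'\cap\langle M,e_B\rangle\}$. Then $P=v^*e_Bv$ for some $v\in\mathcal{GN}^{(1)}(B)$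 if and only if the following two conditions hold: (1) $P\precsim e_B$ in $\langle M,e_B\rangle$, i.e. there is $V\in\langle M,e_B\rangle$ with $V^*V=P$ and $VV^*\le e_B$; (2) $\mathrm{Tr}(Pr)\le\tau(qr)$ for every projection $r\in Z(B)q$. Moreover, whenever $P=v^*e_Bv$ with $v\in\mathcal{GN}^{(1)}(B)$, the projection $v^*v$ lies in $Z(B)q$. -/

import Mathlib

open scoped ENNReal InnerProductSpace

noncomputable section

namespace FiniteInclusion

variable {H : Type*} [NormedAddCommGroup H] [InnerProductSpace ℂ H] [CompleteSpace H]

/-- The von Neumann algebra generated by a set `S` of bounded operators: the double commutant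
of `S ∪ S*`. -/
def generatedBy (S : Set (H →L[ℂ] H)) : VonNeumannAlgebra H where
  toStarSubalgebra := StarSubalgebra.centralizer ℂ (StarSubalgebra.centralizer ℂ S)
  centralizer_centralizer' := by
    simp [Set.centralizer_centralizer_centralizer]

/-- The vector functional `x ↦ ⟨x ξ, ξ⟩`. For `M` in standard form with vector `ξ` this is
the trace `τ`. -/
def vectorTrace (ξ : H) (x : H →L[ℂ] H) : ℂ := ⟪ξ, x ξ⟫_ℂ

/-- `M` is a finite von Neumann algebra standardly represented on `H = L²(M, τ)`, where
`τ(x) = ⟨x ξ, ξ⟩` is a faithful (automatically normal) trace with `τ(1) = 1`, and `ξ` is the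
image of `1 ∈ M` in `H`; thus `‖x ξ‖² = τ(x* x)` for `x ∈ M`, and `M ξ` is dense in `H`. -/
structure IsStandardForm (M : VonNeumannAlgebra H) (ξ : H) : Prop where
  trace_one : vectorTrace ξ 1 = 1
  trace_comm : ∀ x ∈ M, ∀ y ∈ M, vectorTrace ξ (x * y) = vectorTrace ξ (y * x)
  faithful : ∀ x ∈ M, vectorTrace ξ (star x * x) = 0 → x = 0
  dense : Dense {η : H | ∃ x ∈ M, x ξ = η}

/-- `L²(B)`, the closure of `B ξ` in `H`. -/
def l2Subspace (B : VonNeumannAlgebra H) (ξ : H) : Submodule ℂ H :=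
  (B.toStarSubalgebra.toSubalgebra.toSubmodule.map
    (ContinuousLinearMap.apply ℂ H ξ).toLinearMap).topologicalClosure

instance (B : VonNeumannAlgebra H) (ξ : H) : CompleteSpace (l2Subspace B ξ) :=
  (Submodule.isClosed_topologicalClosure _).completeSpace_coe

/-- The Jones projection `e_B`: the orthogonal projection of `H` onto `L²(B)`. -/
def jonesProjection (B : VonNeumannAlgebra H) (ξ : H) : H →L[ℂ] H :=
  (l2Subspace B ξ).starProjection

/-- The basic construction `⟨M, e_B⟩`: the von Neumann algebra generated by `M` and `e_B`. -/
def basicConstruction (M B : VonNeumannAlgebra H) (ξ : H) : VonNeumannAlgebra H :=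
  generatedBy ((M : Set (H →L[ℂ] H)) ∪ {jonesProjection B ξ})

/-- `v` is a partial isometry. -/
def IsPartialIsometry (v : H →L[ℂ] H) : Prop := v * star v * v = v

/-- The canonical trace `Tr` on the positive part of `⟨M, e_B⟩`, the unique faithful normal
semifinite trace with `Tr(x e_B y) = τ(x y)` for `x, y ∈ M`. It is given by
`Tr(t) = ∑ i, ⟨t (vᵢ* ξ), vᵢ* ξ⟩` for any family of partial isometries `vᵢ ∈ ⟨M, e_B⟩` with
`∑ i, vᵢ* e_B vᵢ = 1`; here this is written as the supremum of the same sum over all finite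
families with `∑ i, vᵢ* e_B vᵢ ≤ 1`. (Every such sum equals `∑ i, Tr (t^½ vᵢ* e_B vᵢ t^½)`, so
it is at most `Tr t`, and the finite parts of a family that sums to `1` approach `Tr t`.)
Only its values at positive `t ∈ ⟨M, e_B⟩` are meaningful. -/
def canonicalTrace (M B : VonNeumannAlgebra H) (ξ : H) (t : H →L[ℂ] H) : ℝ≥0∞ :=
  ⨆ (n : ℕ) (v : Fin n → H →L[ℂ] H)
    (_ : (∀ i, v i ∈ basicConstruction M B ξ ∧ IsPartialIsometry (v i)) ∧
      ∑ i, star (v i) * jonesProjection B ξ * v i ≤ 1),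
    ∑ i, ENNReal.ofReal (⟪star (v i) ξ, t (star (v i) ξ)⟫_ℂ).re

/-- Murray–von Neumann subequivalence `p ≾ e` of projections in `N`. -/
def Subequivalent (N : VonNeumannAlgebra H) (p e : H →L[ℂ] H) : Prop :=
  ∃ V ∈ N, star V * V = p ∧ V * star V ≤ e

/-- The intertwiners `GN⁽¹⁾(B)` of `B` in `M`: partial isometries `v ∈ M` with
`v B v* ⊆ B` and `v* v ∈ B`. -/
def intertwiners (M B : VonNeumannAlgebra H) : Set (H →L[ℂ] H) :=
  {v | v ∈ M ∧ IsPartialIsometry v ∧ (∀ b ∈ B, v * b * star v ∈ B) ∧ star v * v ∈ B}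

/-- The relative commutant `B' ∩ N`. -/
def relativeCommutant (B N : VonNeumannAlgebra H) : Set (H →L[ℂ] H) :=
  {x | x ∈ B.commutant ∧ x ∈ N}

/-- The centre `Z(B) = B' ∩ B`. -/
def centre (B : VonNeumannAlgebra H) : Set (H →L[ℂ] H) := relativeCommutant B B

/-- The set `S q = {x q : x ∈ S}`. -/
def cutDown (S : Set (H →L[ℂ] H)) (q : H →L[ℂ] H) : Set (H →L[ℂ] H) :=
  {y | ∃ x ∈ S, y = x * q}

end FiniteInclusion

end

/-!
Let `J : x ξ ↦ x* ξ` be the modular conjugation. Then `⟨M, e_B⟩` commutes with `J B J`, and the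
corner at `e_B` of the commutant of `J B J` is `B e_B`. Hence an operator `T = T e_B` in
`⟨M, e_B⟩` is determined by `T ξ`, and `T = y e_B` as soon as `T ξ = y ξ` with `y ∈ M`.

Suppose `P = V* V` with `V V* ≤ e_B`, and put `η = V* ξ`. The support `r` of the positive part of
the difference of the functionals of `η` and `ξ` on `M` commutes with everything in `q M q` that
centralizes the functional of `η`, in particular with `q B q`; as `B' ∩ M ⊆ B` this forces
`r ∈ Z(B) q`. Condition (2) at `r` says that this positive part vanishes, so `‖x η‖ ≤ ‖x ξ‖` for
`x ∈ M'` and `η = y ξ` with `y ∈ M`, `‖y‖ ≤ 1`. Therefore `V* = y e_B`. Now `e_B y* y e_B = p e_B`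
for a projection `p ∈ B` with `y* y ≤ p` and `τ(y* y) = τ(p)`, so `y` is a partial isometry. Since
`P = y e_B y*` commutes with `q B q`, so does `y y*`, whence `y y* ∈ Z(B) q` and `y*` is the
intertwiner.
-/

noncomputable section

namespace FiniteInclusion

variable {H : Type*} [NormedAddCommGroup H] [InnerProductSpace ℂ H] [CompleteSpace H]

/-! ### The modular conjugation -/

theorem inner_star_apply (x : H →L[ℂ] H) (a b : H) : ⟪star x a, b⟫_ℂ = ⟪a, x b⟫_ℂ := by
  rw [ContinuousLinearMap.star_eq_adjoint, ContinuousLinearMap.adjoint_inner_left]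

theorem inner_apply_star (x : H →L[ℂ] H) (a b : H) : ⟪a, star x b⟫_ℂ = ⟪x a, b⟫_ℂ := by
  rw [ContinuousLinearMap.star_eq_adjoint, ContinuousLinearMap.adjoint_inner_right]

theorem mem_of_forall_commutant {A : VonNeumannAlgebra H} {a : H →L[ℂ] H}
    (h : ∀ x ∈ A.commutant, x * a = a * x) : a ∈ A := by
  rw [← A.commutant_commutant]
  exact VonNeumannAlgebra.mem_commutant_iff.2 h

/-- The linear map `x ↦ x ξ` on a von Neumann algebra. -/
def evalAt (A : VonNeumannAlgebra H) (ξ : H) : A.toStarSubalgebra →ₗ[ℂ] H where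
  toFun x := (x : H →L[ℂ] H) ξ
  map_add' _ _ := rfl
  map_smul' _ _ := rfl

/-- The conjugate-linear map `x ↦ x* ξ` on a von Neumann algebra. -/
def starEvalAt (A : VonNeumannAlgebra H) (ξ : H) :
    A.toStarSubalgebra →ₛₗ[starRingEnd ℂ] H where
  toFun x := star (x : H →L[ℂ] H) ξ
  map_add' x y := by simp
  map_smul' c x := by simp

theorem denseRange_evalAt {A : VonNeumannAlgebra H} {ξ : H}
    (hd : Dense {ζ : H | ∃ x ∈ A, x ξ = ζ}) : DenseRange (evalAt A ξ) := by
  refine hd.mono ?_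
  rintro _ ⟨x, hx, rfl⟩
  exact ⟨⟨x, hx⟩, rfl⟩

theorem exists_mem_apply_eq_of_norm_le {A : VonNeumannAlgebra H} {ξ η : H} {C : ℝ}
    (hd : Dense {ζ : H | ∃ x ∈ A.commutant, x ξ = ζ})
    (hη : ∀ x ∈ A.commutant, ‖x η‖ ≤ C * ‖x ξ‖) :
    ∃ a ∈ A, a ξ = η ∧ ∀ ζ, ‖a ζ‖ ≤ C * ‖ζ‖ := by
  have hb : ∀ x, ‖evalAt A.commutant η x‖ ≤ C * ‖evalAt A.commutant ξ x‖ := fun x => hη x x.2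
  set a : H →L[ℂ] H := (evalAt A.commutant η).extendOfNorm (evalAt A.commutant ξ)
  have ha : ∀ x ∈ A.commutant, a (x ξ) = x η := fun x hx =>
    LinearMap.extendOfNorm_eq (denseRange_evalAt hd) ⟨C, hb⟩
      (⟨x, hx⟩ : A.commutant.toStarSubalgebra)
  refine ⟨a, mem_of_forall_commutant fun x hx => ?_, ?_, fun ζ =>
    LinearMap.norm_extendOfNorm_apply_le (denseRange_evalAt hd) C hb ζ⟩
  · refine ContinuousLinearMap.ext_on (hd.mono Submodule.subset_span) ?_
    rintro _ ⟨y, hy, rfl⟩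
    have hxy := ha (x * y) (mul_mem hx hy)
    simp only [mul_apply_eq_comp] at hxy ⊢
    rw [hxy, ha y hy]
  · simpa using ha 1 (one_mem _)

/-- The modular conjugation `J`, the continuous extension of `x ξ ↦ x* ξ`, `x ∈ M`. -/
def modularConj (M : VonNeumannAlgebra H) (ξ : H) : H →SL[starRingEnd ℂ] H :=
  (starEvalAt M ξ).extendOfNorm (evalAt M ξ)

/-- The operator `J y J`, where `J` is the modular conjugation of `M`. -/
def conjOp (M : VonNeumannAlgebra H) (ξ : H) (y : H →L[ℂ] H) : H →L[ℂ] H :=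
  (modularConj M ξ).comp (y.comp (modularConj M ξ))

theorem conjOp_apply (M : VonNeumannAlgebra H) (ξ : H) (y : H →L[ℂ] H) (ζ : H) :
    conjOp M ξ y ζ = modularConj M ξ (y (modularConj M ξ ζ)) := rfl

namespace IsStandardForm

variable {M : VonNeumannAlgebra H} {ξ : H} (hM : IsStandardForm M ξ)
include hM

theorem inner_apply_apply {x y : H →L[ℂ] H} (hx : x ∈ M) (hy : y ∈ M) :
    ⟪x ξ, y ξ⟫_ℂ = ⟪star y ξ, star x ξ⟫_ℂ := by
  have := hM.trace_comm (star x) (star_mem hx) y hy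
  simp only [vectorTrace, mul_apply_eq_comp, inner_apply_star] at this
  rw [this, inner_star_apply]

theorem norm_star_apply {x : H →L[ℂ] H} (hx : x ∈ M) : ‖star x ξ‖ = ‖x ξ‖ := by
  simp only [@norm_eq_sqrt_re_inner ℂ, hM.inner_apply_apply hx hx]

theorem eq_zero_of_apply {x : H →L[ℂ] H} (hx : x ∈ M) (h : x ξ = 0) : x = 0 :=
  hM.faithful x hx (by simp [vectorTrace, h])

theorem modularConj_apply {x : H →L[ℂ] H} (hx : x ∈ M) :
    modularConj M ξ (x ξ) = star x ξ :=
  LinearMap.extendOfNorm_eq (f := starEvalAt M ξ) (denseRange_evalAt hM.dense)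
    ⟨1, fun y => by simpa using! (hM.norm_star_apply y.2).le⟩
    (⟨x, hx⟩ : M.toStarSubalgebra)

theorem modularConj_self : modularConj M ξ ξ = ξ := by
  simpa using hM.modularConj_apply (one_mem M)

theorem modularConj_modularConj (ζ : H) : modularConj M ξ (modularConj M ξ ζ) = ζ := by
  refine hM.dense.induction (P := fun ζ => modularConj M ξ (modularConj M ξ ζ) = ζ) ?_
    (isClosed_eq (by fun_prop) (by fun_prop)) ζ
  rintro _ ⟨x, hx, rfl⟩
  rw [hM.modularConj_apply hx, hM.modularConj_apply (star_mem hx), star_star]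

theorem inner_modularConj (a b : H) :
    ⟪modularConj M ξ a, modularConj M ξ b⟫_ℂ = ⟪b, a⟫_ℂ := by
  refine hM.dense.induction
    (P := fun a => ⟪modularConj M ξ a, modularConj M ξ b⟫_ℂ = ⟪b, a⟫_ℂ) ?_
    (isClosed_eq (by fun_prop) (by fun_prop)) a
  rintro _ ⟨x, hx, rfl⟩
  refine hM.dense.induction
    (P := fun b => ⟪modularConj M ξ (x ξ), modularConj M ξ b⟫_ℂ = ⟪b, x ξ⟫_ℂ) ?_
    (isClosed_eq (by fun_prop) (by fun_prop)) b
  rintro _ ⟨y, hy, rfl⟩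
  rw [hM.modularConj_apply hx, hM.modularConj_apply hy, hM.inner_apply_apply hy hx]

theorem inner_modularConj_left (a b : H) :
    ⟪modularConj M ξ a, b⟫_ℂ = ⟪modularConj M ξ b, a⟫_ℂ := by
  conv_lhs => rw [← hM.modularConj_modularConj b]
  rw [hM.inner_modularConj]

theorem norm_modularConj (a : H) : ‖modularConj M ξ a‖ = ‖a‖ := by
  simp only [@norm_eq_sqrt_re_inner ℂ, hM.inner_modularConj]

theorem star_conjOp (y : H →L[ℂ] H) : star (conjOp M ξ y) = conjOp M ξ (star y) := by
  refine ContinuousLinearMap.ext fun b => ext_inner_left ℂ fun a => ?_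
  rw [inner_apply_star, conjOp_apply, conjOp_apply, hM.inner_modularConj_left,
    ← inner_star_apply, ← hM.inner_modularConj, hM.modularConj_modularConj]

theorem conjOp_mul (x y : H →L[ℂ] H) : conjOp M ξ (x * y) = conjOp M ξ x * conjOp M ξ y := by
  ext ζ
  simp only [mul_apply_eq_comp, conjOp_apply, hM.modularConj_modularConj]

theorem conjOp_apply_self {y : H →L[ℂ] H} (hy : y ∈ M) : conjOp M ξ y ξ = star y ξ := by
  rw [conjOp_apply, hM.modularConj_self, hM.modularConj_apply hy]

theorem conjOp_apply_apply {x y : H →L[ℂ] H} (hx : x ∈ M) (hy : y ∈ M) :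
    conjOp M ξ y (x ξ) = (x * star y) ξ := by
  rw [conjOp_apply, hM.modularConj_apply hx, ← mul_apply_eq_comp,
    hM.modularConj_apply (mul_mem hy (star_mem hx)), star_mul, star_star]

theorem conjOp_mem_commutant {y : H →L[ℂ] H} (hy : y ∈ M) : conjOp M ξ y ∈ M.commutant := by
  refine VonNeumannAlgebra.mem_commutant_iff.2 fun x hx =>
    ContinuousLinearMap.ext_on (hM.dense.mono Submodule.subset_span) ?_
  rintro _ ⟨z, hz, rfl⟩
  rw [mul_apply_eq_comp, mul_apply_eq_comp, hM.conjOp_apply_apply hz hy, ← mul_apply_eq_comp,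
    ← mul_apply_eq_comp x z, hM.conjOp_apply_apply (mul_mem hx hz) hy, mul_assoc]

theorem dense_commutant : Dense {ζ : H | ∃ x ∈ M.commutant, x ξ = ζ} := by
  refine hM.dense.mono ?_
  rintro _ ⟨x, hx, rfl⟩
  exact ⟨conjOp M ξ (star x), hM.conjOp_mem_commutant (star_mem hx), by
    rw [hM.conjOp_apply_self (star_mem hx), star_star]⟩

theorem modularConj_apply_commutant {x : H →L[ℂ] H} (hx : x ∈ M.commutant) :
    modularConj M ξ (x ξ) = star x ξ := by
  refine hM.dense.eq_of_inner_right (𝕜 := ℂ) ?_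
  rintro _ ⟨a, ha, rfl⟩
  have hax : a (x ξ) = x (a ξ) :=
    congrArg (fun T : H →L[ℂ] H => T ξ) (VonNeumannAlgebra.mem_commutant_iff.1 hx a ha)
  rw [inner_apply_star, ← inner_conj_symm, hM.inner_modularConj_left, hM.modularConj_apply ha,
    inner_star_apply, inner_conj_symm, hax]

end IsStandardForm

/-! ### Projections onto invariant subspaces -/

theorem starProjection_apply_comm_of_invariant {E : Type*} [NormedAddCommGroup E]
    [InnerProductSpace ℂ E] (K : Submodule ℂ E) [K.HasOrthogonalProjection] {f g : E → E}
    (hfg : ∀ a b, ⟪f a, b⟫_ℂ = ⟪a, g b⟫_ℂ) (hf : ∀ ζ ∈ K, f ζ ∈ K) (hg : ∀ ζ ∈ K, g ζ ∈ K)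
    (ζ : E) : K.starProjection (f ζ) = f (K.starProjection ζ) := by
  refine Submodule.eq_starProjection_of_mem_of_inner_eq_zero
    (hf _ (Submodule.starProjection_apply_mem K ζ)) fun w hw => ?_
  rw [inner_sub_left, hfg, hfg, ← inner_sub_left]
  exact Submodule.starProjection_inner_eq_zero _ _ (hg w hw)

theorem starProjection_mul_of_invariant (K : Submodule ℂ H) [K.HasOrthogonalProjection]
    {S : H →L[ℂ] H} (hS : ∀ ζ ∈ K, S ζ ∈ K) (hS_star : ∀ ζ ∈ K, star S ζ ∈ K) :
    K.starProjection * S = S * K.starProjection :=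
  ContinuousLinearMap.ext <|
    starProjection_apply_comm_of_invariant K (fun a b => (inner_apply_star S a b).symm) hS hS_star

/-! ### The Jones projection -/

section Jones

variable {M B : VonNeumannAlgebra H} {ξ : H}

theorem apply_mem_l2Subspace {b : H →L[ℂ] H} (hb : b ∈ B) : b ξ ∈ l2Subspace B ξ :=
  Submodule.le_topologicalClosure _ ⟨b, hb, rfl⟩

theorem l2Subspace_induction {p : H → Prop} (hp : IsClosed {ζ | p ζ})
    (h : ∀ b ∈ B, p (b ξ)) : ∀ ζ ∈ l2Subspace B ξ, p ζ := by
  refine fun ζ hζ => closure_minimal (t := {ζ | p ζ}) ?_ hp hζ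
  rintro _ ⟨b, hb, rfl⟩
  exact h b hb

theorem isStarProjection_jonesProjection : IsStarProjection (jonesProjection B ξ) :=
  isStarProjection_starProjection

theorem star_jonesProjection : star (jonesProjection B ξ) = jonesProjection B ξ :=
  isStarProjection_jonesProjection.isSelfAdjoint.star_eq

theorem jonesProjection_mul_self :
    jonesProjection B ξ * jonesProjection B ξ = jonesProjection B ξ :=
  isStarProjection_jonesProjection.isIdempotentElem

theorem jonesProjection_apply {b : H →L[ℂ] H} (hb : b ∈ B) :
    jonesProjection B ξ (b ξ) = b ξ :=
  Submodule.starProjection_eq_self_iff.2 (apply_mem_l2Subspace hb)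

theorem jonesProjection_self : jonesProjection B ξ ξ = ξ := by
  simpa using jonesProjection_apply (one_mem B) (ξ := ξ)

theorem jonesProjection_mul {b : H →L[ℂ] H} (hb : b ∈ B) :
    jonesProjection B ξ * b = b * jonesProjection B ξ := by
  have hB : ∀ c ∈ B, ∀ ζ ∈ l2Subspace B ξ, c ζ ∈ l2Subspace B ξ := fun c hc =>
    l2Subspace_induction ((Submodule.isClosed_topologicalClosure _).preimage c.continuous)
      fun d hd => apply_mem_l2Subspace (mul_mem hc hd)
  exact starProjection_mul_of_invariant _ (hB b hb) (hB _ (star_mem hb))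

theorem ext_of_mul_jonesProjection {S T : H →L[ℂ] H} (hS : S * jonesProjection B ξ = S)
    (hT : T * jonesProjection B ξ = T) (h : ∀ b ∈ B, S (b ξ) = T (b ξ)) : S = T := by
  have hST := l2Subspace_induction (B := B) (ξ := ξ) (p := fun ζ => S ζ = T ζ)
    (isClosed_eq (by fun_prop) (by fun_prop)) h
  rw [← hS, ← hT]
  exact ContinuousLinearMap.ext fun ζ => hST _ (Submodule.starProjection_apply_mem _ ζ)

theorem subset_generatedBy (S : Set (H →L[ℂ] H)) : S ⊆ (generatedBy S : Set (H →L[ℂ] H)) :=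
  fun _ hx => StarAlgebra.adjoin_le_centralizer_centralizer ℂ S
    (StarAlgebra.subset_adjoin ℂ S hx)

theorem mem_basicConstruction {x : H →L[ℂ] H} (hx : x ∈ M) : x ∈ basicConstruction M B ξ :=
  subset_generatedBy _ (Or.inl hx)

theorem jonesProjection_mem_basicConstruction :
    jonesProjection B ξ ∈ basicConstruction M B ξ :=
  subset_generatedBy _ (Or.inr rfl)

end Jones

/-! ### Operators commuting with the right action -/

/-- `T` commutes with the right action `J B J` of `B`. -/
def IsRightModular (M B : VonNeumannAlgebra H) (ξ : H) (T : H →L[ℂ] H) : Prop :=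
  ∀ b ∈ B, T * conjOp M ξ b = conjOp M ξ b * T

/-- `T` lies in the corner at `e_B` of the commutant of `J B J`. -/
structure IsJonesCorner (M B : VonNeumannAlgebra H) (ξ : H) (T : H →L[ℂ] H) : Prop where
  isRightModular : IsRightModular M B ξ T
  jonesProjection_mul : jonesProjection B ξ * T = T
  mul_jonesProjection : T * jonesProjection B ξ = T

section RightModular

variable {M B : VonNeumannAlgebra H} {ξ : H} {S T : H →L[ℂ] H}

theorem IsRightModular.mul (hS : IsRightModular M B ξ S) (hT : IsRightModular M B ξ T) :
    IsRightModular M B ξ (S * T) := fun b hb => by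
  rw [mul_assoc, hT b hb, ← mul_assoc, hS b hb, mul_assoc]

theorem IsJonesCorner.mul (hS : IsJonesCorner M B ξ S) (hT : IsJonesCorner M B ξ T) :
    IsJonesCorner M B ξ (S * T) where
  isRightModular := hS.isRightModular.mul hT.isRightModular
  jonesProjection_mul := by rw [← mul_assoc, hS.jonesProjection_mul]
  mul_jonesProjection := by rw [mul_assoc, hT.mul_jonesProjection]

end RightModular

namespace IsStandardForm

variable {M B : VonNeumannAlgebra H} {ξ : H} (hM : IsStandardForm M ξ)
include hM

theorem isRightModular_star {T : H →L[ℂ] H} (hT : IsRightModular M B ξ T) :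
    IsRightModular M B ξ (star T) := fun b hb => by
  have := congrArg star (hT (star b) (star_mem hb))
  rw [star_mul, star_mul, hM.star_conjOp, star_star] at this
  exact this.symm

theorem isRightModular_of_mem (hBM : B ≤ M) {x : H →L[ℂ] H} (hx : x ∈ M) :
    IsRightModular M B ξ x := fun _ hb =>
  VonNeumannAlgebra.mem_commutant_iff.1 (hM.conjOp_mem_commutant (hBM hb)) x hx

theorem jonesProjection_modularConj (hBM : B ≤ M) (ζ : H) :
    jonesProjection B ξ (modularConj M ξ ζ) = modularConj M ξ (jonesProjection B ξ ζ) := by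
  have hJ : ∀ ζ ∈ l2Subspace B ξ, modularConj M ξ ζ ∈ l2Subspace B ξ :=
    l2Subspace_induction ((Submodule.isClosed_topologicalClosure _).preimage
      (modularConj M ξ).continuous) fun b hb => by
        rw [hM.modularConj_apply (hBM hb)]
        exact apply_mem_l2Subspace (star_mem hb)
  refine Submodule.eq_starProjection_of_mem_of_inner_eq_zero
    (hJ _ (Submodule.starProjection_apply_mem _ ζ)) fun w hw => ?_
  rw [← map_sub, hM.inner_modularConj_left, ← inner_conj_symm, jonesProjection,
    Submodule.starProjection_inner_eq_zero _ _ (hJ w hw), map_zero]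

theorem conjOp_jonesProjection (hBM : B ≤ M) :
    conjOp M ξ (jonesProjection B ξ) = jonesProjection B ξ := by
  ext ζ
  rw [conjOp_apply, hM.jonesProjection_modularConj hBM, hM.modularConj_modularConj]

theorem isRightModular_jonesProjection (hBM : B ≤ M) :
    IsRightModular M B ξ (jonesProjection B ξ) := fun b hb => by
  rw [← hM.conjOp_jonesProjection hBM, ← hM.conjOp_mul, jonesProjection_mul hb, hM.conjOp_mul]

theorem isRightModular_of_mem_basicConstruction (hBM : B ≤ M) {T : H →L[ℂ] H}
    (hT : T ∈ basicConstruction M B ξ) : IsRightModular M B ξ T := fun b hb => by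
  have hgen : ∀ x ∈ (M : Set (H →L[ℂ] H)) ∪ {jonesProjection B ξ}, IsRightModular M B ξ x := by
    rintro x (hx | rfl)
    · exact hM.isRightModular_of_mem hBM hx
    · exact hM.isRightModular_jonesProjection hBM
  refine ((StarSubalgebra.mem_centralizer_iff ℂ).1 hT (conjOp M ξ b) ?_).1.symm
  refine (StarSubalgebra.mem_centralizer_iff ℂ).2 fun x hx =>
    ⟨hgen x hx b hb, hM.isRightModular_star (hgen x hx) b hb⟩

theorem apply_apply_of_isRightModular (hBM : B ≤ M) {T : H →L[ℂ] H}
    (hT : IsRightModular M B ξ T) {b : H →L[ℂ] H} (hb : b ∈ B) :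
    T (b ξ) = conjOp M ξ (star b) (T ξ) := by
  rw [← mul_apply_eq_comp (conjOp M ξ (star b)), ← hT _ (star_mem hb), mul_apply_eq_comp,
    hM.conjOp_apply_self (hBM (star_mem hb)), star_star]

theorem eq_mul_jonesProjection_of_apply (hBM : B ≤ M) {T y : H →L[ℂ] H}
    (hT : IsRightModular M B ξ T) (hTe : T * jonesProjection B ξ = T) (hy : y ∈ M)
    (hyξ : T ξ = y ξ) : T = y * jonesProjection B ξ := by
  refine ext_of_mul_jonesProjection hTe (by rw [mul_assoc, jonesProjection_mul_self])
    fun b hb => ?_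
  rw [mul_apply_eq_comp, jonesProjection_apply hb, hM.apply_apply_of_isRightModular hBM hT hb,
    hM.apply_apply_of_isRightModular hBM (hM.isRightModular_of_mem hBM hy) hb, hyξ]

theorem eq_of_jonesProjection_mul {x y : H →L[ℂ] H} (hx : x ∈ M) (hy : y ∈ M)
    (h : jonesProjection B ξ * x = jonesProjection B ξ * y) : x = y := by
  have hxy : jonesProjection B ξ * (x - y) = 0 := by rw [mul_sub, h, sub_self]
  have hz : ⟪star (x - y) ξ, star (x - y) ξ⟫_ℂ = 0 := by
    rw [inner_star_apply, ← jonesProjection_self (B := B) (ξ := ξ), ← inner_apply_star,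
      star_jonesProjection, jonesProjection_self, ← mul_apply_eq_comp, hxy, zero_apply,
      inner_zero_right]
  exact sub_eq_zero.1 <| star_eq_zero.1 <|
    hM.eq_zero_of_apply (star_mem (sub_mem hx hy)) (inner_self_eq_zero.1 hz)

theorem eq_of_mul_jonesProjection {x y : H →L[ℂ] H} (hx : x ∈ M) (hy : y ∈ M)
    (h : x * jonesProjection B ξ = y * jonesProjection B ξ) : x = y := by
  refine star_injective (hM.eq_of_jonesProjection_mul (B := B) (star_mem hx) (star_mem hy) ?_)
  simpa only [star_mul, star_jonesProjection] using congrArg star h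

/-! ### The corner at the Jones projection -/

theorem isJonesCorner_star {T : H →L[ℂ] H} (hT : IsJonesCorner M B ξ T) :
    IsJonesCorner M B ξ (star T) where
  isRightModular := hM.isRightModular_star hT.isRightModular
  jonesProjection_mul := by
    simpa only [star_mul, star_jonesProjection] using congrArg star hT.mul_jonesProjection
  mul_jonesProjection := by
    simpa only [star_mul, star_jonesProjection] using congrArg star hT.jonesProjection_mul

theorem isJonesCorner_compression (hBM : B ≤ M) {T : H →L[ℂ] H} (hT : IsRightModular M B ξ T) :
    IsJonesCorner M B ξ (jonesProjection B ξ * T * jonesProjection B ξ) where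
  isRightModular := ((hM.isRightModular_jonesProjection hBM).mul hT).mul
    (hM.isRightModular_jonesProjection hBM)
  jonesProjection_mul := by simp only [← mul_assoc, jonesProjection_mul_self]
  mul_jonesProjection := by rw [mul_assoc, jonesProjection_mul_self]

theorem isJonesCorner_mul_jonesProjection (hBM : B ≤ M) {b : H →L[ℂ] H} (hb : b ∈ B) :
    IsJonesCorner M B ξ (b * jonesProjection B ξ) := by
  have := hM.isJonesCorner_compression hBM (hM.isRightModular_of_mem hBM (hBM hb))
  rwa [jonesProjection_mul hb, mul_assoc, jonesProjection_mul_self] at this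

theorem modularConj_jonesProjection_apply (hBM : B ≤ M) {T : H →L[ℂ] H}
    (hT : IsRightModular M B ξ T) :
    modularConj M ξ (jonesProjection B ξ (T ξ)) = jonesProjection B ξ (star T ξ) := by
  rw [← hM.jonesProjection_modularConj hBM, ← sub_eq_zero, ← map_sub]
  refine (Submodule.starProjection_apply_eq_zero_iff _).2
    (l2Subspace_induction (isClosed_eq (by fun_prop) (by fun_prop)) fun b hb => ?_)
  rw [inner_sub_right, inner_apply_star, sub_eq_zero, hM.apply_apply_of_isRightModular hBM hT hb,
    ← hM.star_conjOp, inner_star_apply, hM.conjOp_apply_self (hBM hb), ← hM.inner_modularConj,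
    hM.modularConj_modularConj, hM.modularConj_apply (hBM hb)]

theorem norm_jonesProjection_star_apply (hBM : B ≤ M) {T : H →L[ℂ] H}
    (hT : IsRightModular M B ξ T) :
    ‖jonesProjection B ξ (star T ξ)‖ = ‖jonesProjection B ξ (T ξ)‖ := by
  rw [← hM.modularConj_jonesProjection_apply hBM hT, hM.norm_modularConj]

theorem modularConj_apply_of_isJonesCorner (hBM : B ≤ M) {T : H →L[ℂ] H}
    (hT : IsJonesCorner M B ξ T) : modularConj M ξ (T ξ) = star T ξ := by
  have := hM.modularConj_jonesProjection_apply hBM hT.isRightModular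
  rwa [← mul_apply_eq_comp, ← mul_apply_eq_comp, hT.jonesProjection_mul,
    (hM.isJonesCorner_star hT).jonesProjection_mul] at this

theorem isJonesCorner_conjOp (hBM : B ≤ M) {S : H →L[ℂ] H} (hS : ∀ b ∈ B, b * S = S * b)
    (heS : jonesProjection B ξ * S = S) (hSe : S * jonesProjection B ξ = S) :
    IsJonesCorner M B ξ (conjOp M ξ S) where
  isRightModular b hb := by rw [← hM.conjOp_mul, ← hM.conjOp_mul, hS b hb]
  jonesProjection_mul := by
    rw [← hM.conjOp_jonesProjection hBM, ← hM.conjOp_mul, heS]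
  mul_jonesProjection := by
    rw [← hM.conjOp_jonesProjection hBM, ← hM.conjOp_mul, hSe]

theorem apply_apply_of_isJonesCorner (hBM : B ≤ M) {S T : H →L[ℂ] H}
    (hS : ∀ b ∈ B, b * S = S * b) (heS : jonesProjection B ξ * S = S)
    (hSe : S * jonesProjection B ξ = S) (hT : IsJonesCorner M B ξ T) :
    S (T ξ) = T (modularConj M ξ (star S ξ)) := by
  have hST := hM.modularConj_apply_of_isJonesCorner hBM
    ((hM.isJonesCorner_conjOp hBM hS heS hSe).mul (hM.isJonesCorner_star hT))
  rw [star_mul, star_star, hM.star_conjOp, mul_apply_eq_comp, mul_apply_eq_comp, conjOp_apply,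
    conjOp_apply, ← hM.modularConj_apply_of_isJonesCorner hBM hT, hM.modularConj_self,
    hM.modularConj_modularConj, hM.modularConj_modularConj] at hST
  exact hST

theorem commute_of_isJonesCorner (hBM : B ≤ M) {S T : H →L[ℂ] H}
    (hS : ∀ b ∈ B, b * S = S * b) (heS : jonesProjection B ξ * S = S)
    (hSe : S * jonesProjection B ξ = S) (hT : IsJonesCorner M B ξ T) : Commute S T := by
  have hSapply : ∀ {R : H →L[ℂ] H}, IsJonesCorner M B ξ R →
      S (R ξ) = R (modularConj M ξ (star S ξ)) := hM.apply_apply_of_isJonesCorner hBM hS heS hSe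
  refine ext_of_mul_jonesProjection (B := B) (ξ := ξ)
    (by rw [mul_assoc, hT.mul_jonesProjection]) (by rw [mul_assoc, hSe]) fun b hb => ?_
  have hbe := hM.isJonesCorner_mul_jonesProjection hBM hb
  calc S (T (b ξ)) = S ((T * (b * jonesProjection B ξ)) ξ) := by
        simp only [mul_apply_eq_comp, jonesProjection_self]
    _ = T ((b * jonesProjection B ξ) (modularConj M ξ (star S ξ))) := hSapply (hT.mul hbe)
    _ = T (S ((b * jonesProjection B ξ) ξ)) := by rw [hSapply hbe]
    _ = T (S (b ξ)) := by rw [mul_apply_eq_comp b, jonesProjection_self]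

end IsStandardForm

theorem norm_abs_apply (x : H →L[ℂ] H) (ζ : H) : ‖CFC.abs x ζ‖ = ‖x ζ‖ := by
  have habs : star (CFC.abs x) = CFC.abs x := (CFC.abs_nonneg x).isSelfAdjoint.star_eq
  have h : ⟪CFC.abs x ζ, CFC.abs x ζ⟫_ℂ = ⟪x ζ, x ζ⟫_ℂ := by
    rw [← inner_apply_star, habs, ← mul_apply_eq_comp, CFC.abs_mul_abs, mul_apply_eq_comp,
      inner_apply_star]
  simp only [@norm_eq_sqrt_re_inner ℂ, h]

theorem norm_apply_apply_le_of_commute {x T : H →L[ℂ] H} (h : Commute (star x * x) T) (ζ : H) :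
    ‖x (T ζ)‖ ≤ ‖T‖ * ‖x ζ‖ := by
  have habs : CFC.abs x * T = T * CFC.abs x := by
    rw [CFC.abs, CFC.sqrt_eq_cfc]
    exact h.cfc_nnreal _
  calc ‖x (T ζ)‖ = ‖T (CFC.abs x ζ)‖ := by
        rw [← norm_abs_apply, ← mul_apply_eq_comp, habs, mul_apply_eq_comp]
    _ ≤ ‖T‖ * ‖x ζ‖ := (T.le_opNorm _).trans_eq (by rw [norm_abs_apply])

namespace IsStandardForm

variable {M B : VonNeumannAlgebra H} {ξ : H} (hM : IsStandardForm M ξ)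
include hM

theorem norm_apply_apply_le_of_isJonesCorner (hBM : B ≤ M) {x T : H →L[ℂ] H}
    (hx : x ∈ B.commutant) (hT : IsJonesCorner M B ξ T) : ‖x (T ξ)‖ ≤ ‖T‖ * ‖x ξ‖ := by
  have hxB := VonNeumannAlgebra.mem_commutant_iff.1 hx
  have hxsB := VonNeumannAlgebra.mem_commutant_iff.1 (star_mem hx)
  set e := jonesProjection B ξ with he
  have hee : e * e = e := jonesProjection_mul_self
  have hes : star e = e := star_jonesProjection
  have hcomm : Commute (star (x * e) * (x * e)) T := by
    rw [star_mul, hes]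
    refine hM.commute_of_isJonesCorner hBM (fun b hb => ?_) ?_ ?_ hT
    · have heb : e * b = b * e := jonesProjection_mul hb
      calc b * (e * star x * (x * e)) = e * (b * star x) * x * e := by
            simp only [← mul_assoc, heb]
        _ = e * star x * (b * x) * e := by rw [hxsB b hb]; simp only [mul_assoc]
        _ = e * star x * (x * e) * b := by rw [hxB b hb]; simp only [mul_assoc, heb]
    · simp only [← he, ← mul_assoc, hee]
    · simp only [← he, mul_assoc, hee]
  have hbound := norm_apply_apply_le_of_commute hcomm ξ
  rwa [mul_apply_eq_comp, mul_apply_eq_comp, ← mul_apply_eq_comp e T, he,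
    hT.jonesProjection_mul, jonesProjection_self] at hbound

theorem exists_eq_mul_jonesProjection (hBM : B ≤ M) {T : H →L[ℂ] H}
    (hT : IsJonesCorner M B ξ T) : ∃ b ∈ B, T = b * jonesProjection B ξ := by
  have hd : Dense {ζ : H | ∃ x ∈ B.commutant, x ξ = ζ} := by
    refine hM.dense_commutant.mono ?_
    rintro _ ⟨x, hx, rfl⟩
    exact ⟨x, VonNeumannAlgebra.mem_commutant_iff.2 fun b hb =>
      VonNeumannAlgebra.mem_commutant_iff.1 hx b (hBM hb), rfl⟩
  obtain ⟨b, hb, hbξ, -⟩ := exists_mem_apply_eq_of_norm_le hd fun x hx =>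
    hM.norm_apply_apply_le_of_isJonesCorner hBM hx hT
  exact ⟨b, hb, hM.eq_mul_jonesProjection_of_apply hBM hT.isRightModular hT.mul_jonesProjection
    (hBM hb) hbξ.symm⟩

theorem vectorTrace_mul_comm_of_isJonesCorner (hBM : B ≤ M) {S T : H →L[ℂ] H}
    (hS : IsJonesCorner M B ξ S) (hT : IsJonesCorner M B ξ T) :
    vectorTrace ξ (S * T) = vectorTrace ξ (T * S) := by
  obtain ⟨a, ha, rfl⟩ := hM.exists_eq_mul_jonesProjection hBM hS
  obtain ⟨b, hb, rfl⟩ := hM.exists_eq_mul_jonesProjection hBM hT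
  have := hM.trace_comm a (hBM ha) b (hBM hb)
  simpa only [vectorTrace, mul_apply_eq_comp, jonesProjection_self, jonesProjection_apply ha,
    jonesProjection_apply hb] using this

end IsStandardForm

/-! ### The graph of `x ξ ↦ x η` -/

section Graph

variable {M : VonNeumannAlgebra H} {ξ η : H}

/-- The closed graph of the map `x ξ ↦ x η`, `x ∈ M'`. -/
def graphSpace (M : VonNeumannAlgebra H) (ξ η : H) : Submodule ℂ (WithLp 2 (H × H)) :=
  (LinearMap.range ((WithLp.linearEquiv 2 ℂ (H × H)).symm.toLinearMap ∘ₗ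
    (evalAt M.commutant ξ).prod (evalAt M.commutant η))).topologicalClosure

instance : CompleteSpace (graphSpace M ξ η) :=
  (Submodule.isClosed_topologicalClosure _).completeSpace_coe

/-- The orthogonal projection onto the closed graph of `x ξ ↦ x η`, `x ∈ M'`. -/
def graphProjection (M : VonNeumannAlgebra H) (ξ η : H) :
    WithLp 2 (H × H) →L[ℂ] WithLp 2 (H × H) :=
  (graphSpace M ξ η).starProjection

/-- The (2, 1) block of the projection onto the closed graph of `x ξ ↦ x η`, `x ∈ M'`. -/
def graphOffDiagonal (M : VonNeumannAlgebra H) (ξ η : H) : H →L[ℂ] H :=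
  WithLp.sndL 2 ℂ H H ∘L graphProjection M ξ η ∘L (WithLp.fstL 2 ℂ H H).adjoint

/-- The (2, 2) block of the projection onto the closed graph of `x ξ ↦ x η`, `x ∈ M'`. If `M` is
in standard form with vector `ξ`, this is the Radon–Nikodym derivative of the vector functional of
`η` with respect to the sum of those of `ξ` and `η`. -/
def relativeDensity (M : VonNeumannAlgebra H) (ξ η : H) : H →L[ℂ] H :=
  WithLp.sndL 2 ℂ H H ∘L graphProjection M ξ η ∘L (WithLp.sndL 2 ℂ H H).adjoint

theorem mem_graphSpace {x : H →L[ℂ] H} (hx : x ∈ M.commutant) :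
    WithLp.toLp 2 (x ξ, x η) ∈ graphSpace M ξ η :=
  Submodule.le_topologicalClosure _ ⟨⟨x, hx⟩, rfl⟩

theorem graphSpace_induction {p : WithLp 2 (H × H) → Prop} (hp : IsClosed {k | p k})
    (h : ∀ x ∈ M.commutant, p (WithLp.toLp 2 (x ξ, x η))) : ∀ k ∈ graphSpace M ξ η, p k := by
  refine fun k hk => closure_minimal (t := {k | p k}) ?_ hp hk
  rintro _ ⟨x, rfl⟩
  exact h x x.2

theorem adjoint_fstL_apply (ζ : H) :
    (WithLp.fstL 2 ℂ H H).adjoint ζ = WithLp.toLp 2 (ζ, (0 : H)) :=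
  ext_inner_right ℂ fun k => by
    simp [ContinuousLinearMap.adjoint_inner_left, WithLp.prod_inner_apply]

theorem adjoint_sndL_apply (ζ : H) :
    (WithLp.sndL 2 ℂ H H).adjoint ζ = WithLp.toLp 2 ((0 : H), ζ) :=
  ext_inner_right ℂ fun k => by
    simp [ContinuousLinearMap.adjoint_inner_left, WithLp.prod_inner_apply]

theorem graphOffDiagonal_apply (ζ : H) :
    graphOffDiagonal M ξ η ζ = (graphProjection M ξ η (WithLp.toLp 2 (ζ, (0 : H)))).snd := by
  rw [← adjoint_fstL_apply]; rfl

theorem relativeDensity_apply (ζ : H) :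
    relativeDensity M ξ η ζ = (graphProjection M ξ η (WithLp.toLp 2 ((0 : H), ζ))).snd := by
  rw [← adjoint_sndL_apply]; rfl

theorem graphOffDiagonal_add_relativeDensity (α β : H) :
    graphOffDiagonal M ξ η α + relativeDensity M ξ η β =
      (graphProjection M ξ η (WithLp.toLp 2 (α, β))).snd := by
  rw [graphOffDiagonal_apply, relativeDensity_apply, ← WithLp.add_snd, ← map_add,
    ← WithLp.toLp_add, Prod.mk_add_mk, add_zero, zero_add]

theorem graphProjection_diag {x : H →L[ℂ] H} (hx : x ∈ M.commutant) (α β : H) :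
    graphProjection M ξ η (WithLp.toLp 2 (x α, x β)) =
      WithLp.toLp 2 (x (graphProjection M ξ η (WithLp.toLp 2 (α, β))).fst,
        x (graphProjection M ξ η (WithLp.toLp 2 (α, β))).snd) := by
  set diag : (H →L[ℂ] H) → WithLp 2 (H × H) → WithLp 2 (H × H) :=
    fun y k => WithLp.toLp 2 (y k.fst, y k.snd)
  have hdiag : ∀ y ∈ M.commutant, ∀ k ∈ graphSpace M ξ η, diag y k ∈ graphSpace M ξ η :=
    fun y hy => graphSpace_induction
      ((Submodule.isClosed_topologicalClosure _).preimage (by fun_prop))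
      fun z hz => mem_graphSpace (mul_mem hy hz)
  refine starProjection_apply_comm_of_invariant (f := diag x) (g := diag (star x)) _
    (fun k l => ?_) (hdiag x hx) (hdiag _ (star_mem hx)) (WithLp.toLp 2 (α, β))
  simp [diag, WithLp.prod_inner_apply, inner_apply_star]

theorem graphOffDiagonal_mem : graphOffDiagonal M ξ η ∈ M :=
  mem_of_forall_commutant fun x hx => by
    ext ζ
    have := graphProjection_diag (ξ := ξ) (η := η) hx ζ 0
    rw [map_zero] at this
    simp only [mul_apply_eq_comp, graphOffDiagonal_apply, this, WithLp.toLp_snd]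

theorem relativeDensity_mem : relativeDensity M ξ η ∈ M :=
  mem_of_forall_commutant fun x hx => by
    ext ζ
    have := graphProjection_diag (ξ := ξ) (η := η) hx 0 ζ
    rw [map_zero] at this
    simp only [mul_apply_eq_comp, relativeDensity_apply, this, WithLp.toLp_snd]

theorem isSelfAdjoint_relativeDensity : IsSelfAdjoint (relativeDensity M ξ η) :=
  (isStarProjection_starProjection (U := graphSpace M ξ η)).isSelfAdjoint.conj_adjoint _

theorem graphOffDiagonal_add_relativeDensity_self :
    graphOffDiagonal M ξ η ξ + relativeDensity M ξ η η = η := by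
  have hmem : WithLp.toLp 2 (ξ, η) ∈ graphSpace M ξ η := by
    simpa using mem_graphSpace (ξ := ξ) (η := η) (one_mem M.commutant)
  rw [graphOffDiagonal_add_relativeDensity, graphProjection,
    Submodule.starProjection_eq_self_iff.2 hmem, WithLp.toLp_snd]

theorem relativeDensity_apply_eq_of_inner_eq {α β : H}
    (h : ∀ x ∈ M.commutant, ⟪x η, β⟫_ℂ = ⟪x ξ, α⟫_ℂ) :
    relativeDensity M ξ η β = graphOffDiagonal M ξ η α := by
  have hperp : graphProjection M ξ η (WithLp.toLp 2 (-α, β)) = 0 := by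
    refine (Submodule.starProjection_apply_eq_zero_iff _).2
      (graphSpace_induction (isClosed_eq (by fun_prop) (by fun_prop)) fun x hx => ?_)
    simp [WithLp.prod_inner_apply, h x hx]
  have := graphOffDiagonal_add_relativeDensity (M := M) (ξ := ξ) (η := η) (-α) β
  rwa [hperp, map_neg, WithLp.zero_snd, neg_add_eq_zero, eq_comm] at this

theorem norm_apply_le_of_relativeDensity_le
    (ht : ∀ ζ, 2 * (⟪ζ, relativeDensity M ξ η ζ⟫_ℂ).re ≤ ‖ζ‖ ^ 2) {x : H →L[ℂ] H}
    (hx : x ∈ M.commutant) : ‖x η‖ ≤ ‖x ξ‖ := by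
  set p := graphProjection M ξ η
  set k : WithLp 2 (H × H) := WithLp.toLp 2 (x ξ, x η)
  set l : WithLp 2 (H × H) := WithLp.toLp 2 ((0 : H), x η)
  have hp : ∀ a b, ⟪p a, b⟫_ℂ = ⟪a, p b⟫_ℂ :=
    Submodule.inner_starProjection_left_eq_right (graphSpace M ξ η)
  have hpk : p k = k := Submodule.starProjection_eq_self_iff.2 (mem_graphSpace hx)
  have hpp : p (p l) = p l :=
    Submodule.starProjection_eq_self_iff.2 (Submodule.starProjection_apply_mem _ _)
  have hpl : ‖p l‖ ^ 2 = (⟪x η, relativeDensity M ξ η (x η)⟫_ℂ).re := by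
    rw [relativeDensity_apply, ← inner_self_eq_norm_sq (𝕜 := ℂ), hp, hpp, WithLp.prod_inner_apply]
    simp [l, p]
  have hk : ‖k‖ ^ 2 = ‖x ξ‖ ^ 2 + ‖x η‖ ^ 2 := WithLp.prod_norm_sq_eq_of_L2 k
  have hkl : ‖x η‖ ^ 2 ≤ ‖k‖ * ‖p l‖ := by
    have hin : ⟪k, p l⟫_ℂ = ⟪x η, x η⟫_ℂ := by
      rw [← hp, hpk, WithLp.prod_inner_apply]
      simp [k, l]
    calc ‖x η‖ ^ 2 = ‖⟪k, p l⟫_ℂ‖ := by rw [hin, inner_self_eq_norm_sq_to_K]; simp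
      _ ≤ ‖k‖ * ‖p l‖ := norm_inner_le_norm _ _
  have hsq : ‖x η‖ ^ 2 * ‖x η‖ ^ 2 ≤ (‖x ξ‖ ^ 2 + ‖x η‖ ^ 2) / 2 * ‖x η‖ ^ 2 := by
    calc ‖x η‖ ^ 2 * ‖x η‖ ^ 2 ≤ (‖k‖ * ‖p l‖) * (‖k‖ * ‖p l‖) := by gcongr
      _ = ‖k‖ ^ 2 * ‖p l‖ ^ 2 := by ring
      _ ≤ (‖x ξ‖ ^ 2 + ‖x η‖ ^ 2) * (‖x η‖ ^ 2 / 2) := by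
        rw [hk, hpl]
        gcongr
        linarith [ht (x η)]
      _ = _ := by ring
  rcases (norm_nonneg (x η)).eq_or_lt with h0 | h0
  · exact h0 ▸ norm_nonneg _
  · have := le_of_mul_le_mul_right hsq (by positivity)
    exact (sq_le_sq₀ (norm_nonneg _) (norm_nonneg _)).1 (by linarith)

end Graph

/-! ### Spectral projections -/

omit [CompleteSpace H] in
theorem re_inner_nonneg_of_nonneg {a : H →L[ℂ] H} (ha : 0 ≤ a) (ζ : H) : 0 ≤ (⟪ζ, a ζ⟫_ℂ).re :=
  ((ContinuousLinearMap.nonneg_iff_isPositive a).1 ha).re_inner_nonneg_right ζ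

theorem re_inner_star_mul_self_apply (x : H →L[ℂ] H) (ζ : H) :
    (⟪ζ, (star x * x) ζ⟫_ℂ).re = ‖x ζ‖ ^ 2 := by
  rw [mul_apply_eq_comp, inner_apply_star]
  exact inner_self_eq_norm_sq (𝕜 := ℂ) (x ζ)

theorem re_inner_apply_of_isStarProjection {p : H →L[ℂ] H} (hp : IsStarProjection p) (ζ : H) :
    (⟪ζ, p ζ⟫_ℂ).re = ‖p ζ‖ ^ 2 := by
  rw [← re_inner_star_mul_self_apply, hp.isSelfAdjoint.star_eq, hp.isIdempotentElem.eq]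

theorem apply_eq_zero_of_re_inner_eq_zero {a : H →L[ℂ] H} (ha : 0 ≤ a) {ζ : H}
    (h : (⟪ζ, a ζ⟫_ℂ).re = 0) : a ζ = 0 := by
  obtain ⟨s, rfl⟩ := CStarAlgebra.nonneg_iff_eq_star_mul_self.1 ha
  rw [re_inner_star_mul_self_apply, sq_eq_zero_iff, norm_eq_zero] at h
  rw [mul_apply_eq_comp, h, map_zero]

theorem exists_rangeProjection {a : H →L[ℂ] H} (ha : IsSelfAdjoint a) :
    ∃ r : H →L[ℂ] H, IsStarProjection r ∧ r * a = a ∧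
      (∀ n : H →L[ℂ] H, n * a = 0 → n * r = 0) ∧
      ∀ S : H →L[ℂ] H, Commute S a → Commute S r := by
  set K := (LinearMap.range a.toLinearMap).topologicalClosure
  have : CompleteSpace K := (Submodule.isClosed_topologicalClosure _).completeSpace_coe
  have hK : ∀ ω, a ω ∈ K := fun ω => Submodule.le_topologicalClosure _ ⟨ω, rfl⟩
  have hinv : ∀ S : H →L[ℂ] H, Commute S a → ∀ ζ ∈ K, S ζ ∈ K := fun S hS ζ hζ => by
    refine map_mem_closure S.continuous hζ ?_
    rintro _ ⟨ω, rfl⟩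
    exact ⟨S ω, (congrArg (fun T : H →L[ℂ] H => T ω) hS).symm⟩
  refine ⟨K.starProjection, isStarProjection_starProjection, ?_, fun n hn => ?_, fun S hS => ?_⟩
  · ext ω
    exact Submodule.starProjection_eq_self_iff.2 (hK ω)
  · have hnK : ∀ ζ ∈ K, n ζ = 0 := fun ζ hζ => by
      refine closure_minimal (t := {ζ | n ζ = 0}) ?_ (isClosed_eq (by fun_prop) (by fun_prop)) hζ
      rintro _ ⟨ω, rfl⟩
      exact congrArg (fun T : H →L[ℂ] H => T ω) hn
    ext ω
    exact hnK _ (Submodule.starProjection_apply_mem _ _)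
  · have hS_star : Commute (star S) a := by simpa [ha.star_eq] using hS.star_star
    exact (starProjection_mul_of_invariant K (hinv S hS) (hinv _ hS_star)).symm

theorem exists_isStarProjection_mul_eq_posPart {u : H →L[ℂ] H} (hu : IsSelfAdjoint u) :
    ∃ r : H →L[ℂ] H, IsStarProjection r ∧ r * u = u⁺ ∧
      (∀ n : H →L[ℂ] H, n * u = 0 → n * r = 0) ∧
      ∀ S : H →L[ℂ] H, Commute S u → Commute S r := by
  have hpos : IsSelfAdjoint u⁺ := (CFC.posPart_nonneg u).isSelfAdjoint
  obtain ⟨r, hr, hra, hker, hcomm⟩ := exists_rangeProjection hpos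
  have hur : u = u⁺ - u⁻ := (CFC.posPart_sub_negPart u hu).symm
  refine ⟨r, hr, ?_, fun n hn => hker n ?_, fun S hS => hcomm S ?_⟩
  · have hneg : r * u⁻ = 0 := by
      have := congrArg star (hker u⁻ (CFC.negPart_mul_posPart u))
      rwa [star_mul, hr.isSelfAdjoint.star_eq, (CFC.negPart_nonneg u).isSelfAdjoint.star_eq,
        star_zero] at this
    nth_rw 1 [hur]
    rw [mul_sub, hra, hneg, sub_zero]
  · have hpp : n * (u⁺ * u⁺) = 0 := by
      have : u⁺ * u⁺ = u * u⁺ := by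
        nth_rw 3 [hur]
        rw [sub_mul, CFC.negPart_mul_posPart, sub_zero]
      rw [this, ← mul_assoc, hn, zero_mul]
    rw [← CStarRing.mul_star_self_eq_zero_iff, star_mul, hpos.star_eq, mul_assoc,
      ← mul_assoc u⁺, ← mul_assoc, hpp, zero_mul]
  · exact (hS.symm.cfcₙ_real _).symm

/-! ### The Radon–Nikodym derivative of a vector functional -/

/-- The elements of `M` that centralize the vector functional of `η` on `M`. -/
def vectorCentralizer (M : VonNeumannAlgebra H) (η : H) : Set (H →L[ℂ] H) :=
  {d | d ∈ M ∧ ∀ m ∈ M, vectorTrace η (d * m) = vectorTrace η (m * d)}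

theorem two_smul_relativeDensity_sub_mem {M : VonNeumannAlgebra H} {ξ η : H} {q : H →L[ℂ] H}
    (hq : q ∈ M) : (2 : ℂ) • relativeDensity M ξ η - q ∈ M := by
  have ht : relativeDensity M ξ η ∈ M := relativeDensity_mem
  rw [two_smul]
  exact sub_mem (add_mem ht ht) hq

theorem isSelfAdjoint_two_smul_relativeDensity_sub {M : VonNeumannAlgebra H} {ξ η : H}
    {q : H →L[ℂ] H} (hq : IsStarProjection q) :
    IsSelfAdjoint ((2 : ℂ) • relativeDensity M ξ η - q) := by
  have h2 : IsSelfAdjoint (2 : ℂ) := by simp [IsSelfAdjoint]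
  exact (h2.smul isSelfAdjoint_relativeDensity).sub hq.isSelfAdjoint

namespace IsStandardForm

variable {M : VonNeumannAlgebra H} {ξ : H} (hM : IsStandardForm M ξ)
include hM

theorem vectorTrace_mul_relativeDensity (η : H) {m : H →L[ℂ] H} (hm : m ∈ M) :
    vectorTrace ξ (m * relativeDensity M ξ η) + vectorTrace η (m * relativeDensity M ξ η) =
      vectorTrace η m := by
  set t := relativeDensity M ξ η
  set s := graphOffDiagonal M ξ η
  have hs : s ∈ M := graphOffDiagonal_mem
  have hpair : t (m ξ) = s (modularConj M ξ (star m η)) := by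
    refine relativeDensity_apply_eq_of_inner_eq fun x hx => ?_
    have hxm : star x (m ξ) = m (star x ξ) := congrArg (fun T : H →L[ℂ] H => T ξ)
      (VonNeumannAlgebra.mem_commutant_iff.1 (star_mem hx) m hm).symm
    rw [← inner_apply_star, hxm, ← inner_star_apply, ← hM.inner_modularConj,
      ← hM.modularConj_apply_commutant hx, hM.modularConj_modularConj]
  have htrace : vectorTrace ξ (m * t) = ⟪η, m (s ξ)⟫_ℂ := by
    rw [hM.trace_comm m hm t relativeDensity_mem, vectorTrace, mul_apply_eq_comp, hpair,
      ← inner_star_apply, ← hM.modularConj_apply hs, hM.inner_modularConj, inner_star_apply]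
  rw [htrace, vectorTrace, vectorTrace, mul_apply_eq_comp, ← inner_add_right, ← map_add,
    graphOffDiagonal_add_relativeDensity_self]

theorem eq_of_forall_vectorTrace_add (η : H) {c d : H →L[ℂ] H} (hc : c ∈ M) (hd : d ∈ M)
    (h : ∀ m ∈ M, vectorTrace ξ (m * c) + vectorTrace η (m * c) =
      vectorTrace ξ (m * d) + vectorTrace η (m * d)) : c = d := by
  have hcd := sub_mem hc hd
  have hre := congrArg Complex.re (h _ (star_mem hcd))
  rw [← sub_eq_zero] at hre
  have hsum : ‖(c - d) ξ‖ ^ 2 + ‖(c - d) η‖ ^ 2 = 0 := by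
    rw [← re_inner_star_mul_self_apply, ← re_inner_star_mul_self_apply, ← hre]
    simp only [vectorTrace, mul_apply_eq_comp, sub_apply, map_sub, inner_sub_right,
      Complex.add_re, Complex.sub_re]
    ring
  refine sub_eq_zero.1 (hM.eq_zero_of_apply hcd ?_)
  rw [← norm_eq_zero, ← sq_eq_zero_iff]
  exact le_antisymm (by linarith [sq_nonneg ‖(c - d) η‖]) (sq_nonneg _)

theorem commute_relativeDensity {η : H} {d : H →L[ℂ] H} (hd : d ∈ vectorCentralizer M η) :
    Commute d (relativeDensity M ξ η) := by
  obtain ⟨hdM, hdη⟩ := hd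
  have ht : relativeDensity M ξ η ∈ M := relativeDensity_mem
  refine hM.eq_of_forall_vectorTrace_add η (mul_mem hdM ht) (mul_mem ht hdM) fun m hm => ?_
  calc vectorTrace ξ (m * (d * relativeDensity M ξ η))
        + vectorTrace η (m * (d * relativeDensity M ξ η)) = vectorTrace η (m * d) := by
        rw [← mul_assoc, hM.vectorTrace_mul_relativeDensity η (mul_mem hm hdM)]
    _ = vectorTrace η (d * m) := (hdη m hm).symm
    _ = vectorTrace ξ (d * m * relativeDensity M ξ η)
        + vectorTrace η (d * m * relativeDensity M ξ η) :=
        (hM.vectorTrace_mul_relativeDensity η (mul_mem hdM hm)).symm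
    _ = vectorTrace ξ (m * (relativeDensity M ξ η * d))
        + vectorTrace η (m * (relativeDensity M ξ η * d)) := by
        rw [mul_assoc, hM.trace_comm d hdM _ (mul_mem hm ht), hdη _ (mul_mem hm ht),
          mul_assoc]

theorem mul_relativeDensity_of_apply_eq {η : H} {q : H →L[ℂ] H} (hqM : q ∈ M) (hqη : q η = η) :
    q * relativeDensity M ξ η = relativeDensity M ξ η := by
  have ht : relativeDensity M ξ η ∈ M := relativeDensity_mem
  refine hM.eq_of_forall_vectorTrace_add η (mul_mem hqM ht) ht fun m hm => ?_
  rw [← mul_assoc, hM.vectorTrace_mul_relativeDensity η (mul_mem hm hqM),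
    hM.vectorTrace_mul_relativeDensity η hm, vectorTrace, vectorTrace, mul_apply_eq_comp, hqη]

theorem vectorTrace_mul_two_smul_relativeDensity_sub {η : H} {q r : H →L[ℂ] H} (hr : r ∈ M)
    (hrq : r * q = r) :
    vectorTrace ξ (r * ((2 : ℂ) • relativeDensity M ξ η - q))
        + vectorTrace η (r * ((2 : ℂ) • relativeDensity M ξ η - q)) =
      vectorTrace η r - vectorTrace ξ r := by
  have h := hM.vectorTrace_mul_relativeDensity η hr
  rw [mul_sub, hrq, mul_smul_comm]
  simp only [vectorTrace, sub_apply, smul_apply, inner_sub_right, inner_smul_right] at h ⊢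
  linear_combination 2 * h

theorem exists_projection_mul_eq_posPart {η : H} {q : H →L[ℂ] H} (hq : IsStarProjection q)
    (hqM : q ∈ M) (hqη : q η = η) :
    ∃ r ∈ M, IsStarProjection r ∧ q * r = r ∧
      r * ((2 : ℂ) • relativeDensity M ξ η - q) = ((2 : ℂ) • relativeDensity M ξ η - q)⁺ ∧
      ∀ d ∈ vectorCentralizer M η, Commute d q → Commute d r := by
  set u := (2 : ℂ) • relativeDensity M ξ η - q with hu
  have huM : u ∈ M := two_smul_relativeDensity_sub_mem hqM
  obtain ⟨r, hrp, hru, hker, hcomm⟩ :=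
    exists_isStarProjection_mul_eq_posPart (isSelfAdjoint_two_smul_relativeDensity_sub hq)
  refine ⟨r, mem_of_forall_commutant fun x hx =>
    hcomm x (VonNeumannAlgebra.mem_commutant_iff.1 hx u huM).symm, hrp, ?_, hru, fun d hd hdq =>
    hcomm d (((hM.commute_relativeDensity hd).smul_right (2 : ℂ)).sub_right hdq)⟩
  have hqu : (1 - q) * u = 0 := by
    rw [hu, sub_mul, one_mul, mul_sub, mul_smul_comm, hM.mul_relativeDensity_of_apply_eq hqM hqη,
      hq.isIdempotentElem.eq, sub_self]
  have := hker _ hqu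
  rwa [sub_mul, one_mul, sub_eq_zero, eq_comm] at this

theorem two_smul_relativeDensity_le {η : H} {q : H →L[ℂ] H} (hq : IsStarProjection q)
    (hqM : q ∈ M) (hqη : q η = η)
    (hr : ∀ r ∈ M, IsStarProjection r → q * r = r →
      (∀ d ∈ vectorCentralizer M η, Commute d q → Commute d r) → ‖r η‖ ≤ ‖r ξ‖) :
    (2 : ℂ) • relativeDensity M ξ η ≤ q := by
  obtain ⟨r, hrM, hrp, hqr, hru, hcomm⟩ := hM.exists_projection_mul_eq_posPart hq hqM hqη
  have hrq : r * q = r := by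
    simpa only [star_mul, hq.isSelfAdjoint.star_eq, hrp.isSelfAdjoint.star_eq]
      using congrArg star hqr
  have hsum := congrArg Complex.re
    (hM.vectorTrace_mul_two_smul_relativeDensity_sub (η := η) hrM hrq)
  have husa := isSelfAdjoint_two_smul_relativeDensity_sub (M := M) (ξ := ξ) (η := η) hq
  rw [hru, Complex.add_re, Complex.sub_re] at hsum
  have huM := hru ▸ mul_mem hrM (two_smul_relativeDensity_sub_mem (ξ := ξ) (η := η) hqM)
  rw [← sub_nonpos]
  generalize (2 : ℂ) • relativeDensity M ξ η - q = u at hsum husa huM ⊢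
  simp only [vectorTrace, re_inner_apply_of_isStarProjection hrp] at hsum
  have hξ := re_inner_nonneg_of_nonneg (CFC.posPart_nonneg u) ξ
  have hη := re_inner_nonneg_of_nonneg (CFC.posPart_nonneg u) η
  have hsq : ‖r η‖ ^ 2 ≤ ‖r ξ‖ ^ 2 := by gcongr; exact hr r hrM hrp hqr hcomm
  refine (CFC.posPart_eq_zero_iff u husa).1 (hM.eq_zero_of_apply huM ?_)
  exact apply_eq_zero_of_re_inner_eq_zero (CFC.posPart_nonneg u) (by linarith)

theorem norm_apply_le_of_forall_projection {η : H} {q : H →L[ℂ] H} (hq : IsStarProjection q)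
    (hqM : q ∈ M) (hqη : q η = η)
    (hr : ∀ r ∈ M, IsStarProjection r → q * r = r →
      (∀ d ∈ vectorCentralizer M η, Commute d q → Commute d r) → ‖r η‖ ≤ ‖r ξ‖)
    {x : H →L[ℂ] H} (hx : x ∈ M.commutant) : ‖x η‖ ≤ ‖x ξ‖ := by
  refine norm_apply_le_of_relativeDensity_le (fun ζ => ?_) hx
  have := re_inner_nonneg_of_nonneg
    (sub_nonneg.2 ((hM.two_smul_relativeDensity_le hq hqM hqη hr).trans hq.le_one)) ζ
  simp only [sub_apply, smul_apply, one_apply_eq_self, inner_sub_right, inner_smul_right,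
    inner_self_eq_norm_sq_to_K, Complex.sub_re, sub_nonneg] at this
  simpa [← Complex.ofReal_pow] using this

end IsStandardForm

/-! ### Corners and relative commutants -/

section CutDown

variable {M B N : VonNeumannAlgebra H} {q P r : H →L[ℂ] H}

theorem mul_eq_of_mem_cutDown (hq : IsStarProjection q) {S : Set (H →L[ℂ] H)}
    (hP : P ∈ cutDown S q) : P * q = P := by
  obtain ⟨x, -, rfl⟩ := hP
  rw [mul_assoc, hq.isIdempotentElem.eq]

theorem mul_eq_comm_of_isStarProjection (hq : IsStarProjection q) (hP : IsStarProjection P) :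
    P * q = P ↔ q * P = P :=
  (hP.le_iff_mul_eq_left hq).symm.trans (hP.le_iff_mul_eq_right hq)

theorem commute_of_mem_cutDown (hP : P ∈ cutDown (relativeCommutant B N) q)
    {b : H →L[ℂ] H} (hb : b ∈ B) (hbq : Commute b q) : Commute b P := by
  obtain ⟨x, ⟨hx, -⟩, rfl⟩ := hP
  exact Commute.mul_right (VonNeumannAlgebra.mem_commutant_iff.1 hx b hb) hbq

theorem relativeCommutant_subset_centre
    (hcomm : relativeCommutant B M ⊆ (B : Set (H →L[ℂ] H))) :
    relativeCommutant B M ⊆ centre B := fun _ hx => ⟨hx.1, hcomm hx⟩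

omit [CompleteSpace H] in
theorem cutDown_subset {S T : Set (H →L[ℂ] H)} (h : S ⊆ T) (q : H →L[ℂ] H) :
    cutDown S q ⊆ cutDown T q := by
  rintro _ ⟨x, hx, rfl⟩
  exact ⟨x, h hx, rfl⟩

theorem commute_corner (hq : IsStarProjection q) (b : H →L[ℂ] H) : Commute (q * b * q) q := by
  have := hq.isIdempotentElem.eq
  rw [Commute, SemiconjBy, mul_assoc (q * b), this, ← mul_assoc, ← mul_assoc, this]

end CutDown

/-- The closed span of `B r H`, the range of the smallest projection of `B'` above `r`. -/
def orbitSpan (B : VonNeumannAlgebra H) (r : H →L[ℂ] H) : Submodule ℂ H :=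
  (Submodule.span ℂ {ζ | ∃ b ∈ B, ∃ ω, b (r ω) = ζ}).topologicalClosure

section OrbitSpan

variable {M B : VonNeumannAlgebra H} {q r : H →L[ℂ] H}

instance : CompleteSpace (orbitSpan B r) :=
  (Submodule.isClosed_topologicalClosure _).completeSpace_coe

theorem apply_apply_mem_orbitSpan {b : H →L[ℂ] H} (hb : b ∈ B) (ω : H) :
    b (r ω) ∈ orbitSpan B r :=
  Submodule.le_topologicalClosure _ (Submodule.subset_span ⟨b, hb, ω, rfl⟩)

theorem orbitSpan_le {K : Submodule ℂ H} (hK : IsClosed (K : Set H))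
    (h : ∀ b ∈ B, ∀ ω, b (r ω) ∈ K) : orbitSpan B r ≤ K := by
  refine Submodule.topologicalClosure_minimal _ (Submodule.span_le.2 ?_) hK
  rintro _ ⟨b, hb, ω, rfl⟩
  exact h b hb ω

theorem apply_mem_orbitSpan {S : H →L[ℂ] H} (h : ∀ b ∈ B, ∀ ω, S (b (r ω)) ∈ orbitSpan B r) :
    ∀ ζ ∈ orbitSpan B r, S ζ ∈ orbitSpan B r :=
  orbitSpan_le (K := (orbitSpan B r).comap S.toLinearMap)
    ((Submodule.isClosed_topologicalClosure _).preimage S.continuous) h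

theorem starProjection_orbitSpan_mem_relativeCommutant (hBM : B ≤ M) (hr : r ∈ M) :
    (orbitSpan B r).starProjection ∈ relativeCommutant B M := by
  have hB : ∀ c ∈ B, ∀ ζ ∈ orbitSpan B r, c ζ ∈ orbitSpan B r := fun c hc =>
    apply_mem_orbitSpan fun b hb => apply_apply_mem_orbitSpan (mul_mem hc hb)
  have hM : ∀ x ∈ M.commutant, ∀ ζ ∈ orbitSpan B r, x ζ ∈ orbitSpan B r := fun x hx =>
    apply_mem_orbitSpan fun b hb ω => by
      have hxbr := VonNeumannAlgebra.mem_commutant_iff.1 hx _ (mul_mem (hBM hb) hr)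
      rw [← mul_apply_eq_comp b, ← mul_apply_eq_comp x, ← hxbr]
      exact apply_apply_mem_orbitSpan hb (x ω)
  refine ⟨VonNeumannAlgebra.mem_commutant_iff.2 fun c hc => ?_,
    mem_of_forall_commutant fun x hx => ?_⟩
  · exact (starProjection_mul_of_invariant _ (hB c hc) (hB _ (star_mem hc))).symm
  · exact (starProjection_mul_of_invariant _ (hM x hx) (hM _ (star_mem hx))).symm

theorem mul_starProjection_orbitSpan (hr : IsStarProjection r) (hqr : q * r = r) (hrq : r * q = r)
    (hcomm : ∀ b ∈ B, Commute (q * b * q) r) : (q - r) * (orbitSpan B r).starProjection = 0 := by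
  have hzero : ∀ b ∈ B, (q - r) * (b * r) = 0 := fun b hb => by
    have hqb : q * b * r = r * (q * b * q) := by
      rw [← (hcomm b hb).eq, mul_assoc (q * b), hqr]
    calc (q - r) * (b * r) = q * b * r - r * (q * b * r) := by
          rw [sub_mul, mul_assoc q, ← mul_assoc r q, hrq]
      _ = 0 := by rw [hqb, ← mul_assoc r r, hr.isIdempotentElem.eq, sub_self]
  have hker : orbitSpan B r ≤ LinearMap.ker (q - r).toLinearMap :=
    orbitSpan_le (ContinuousLinearMap.isClosed_ker (q - r)) fun b hb ω =>
      congrArg (fun T : H →L[ℂ] H => T ω) (hzero b hb)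
  ext ω
  exact hker (Submodule.starProjection_apply_mem _ ω)

theorem mem_cutDown_of_commute_corner (hBM : B ≤ M) (hq : IsStarProjection q) (hqB : q ∈ B)
    (hrM : r ∈ M) (hr : IsStarProjection r) (hqr : q * r = r)
    (hcomm : ∀ b ∈ B, Commute (q * b * q) r) : r ∈ cutDown (relativeCommutant B M) q := by
  have hrq : r * q = r := (mul_eq_comm_of_isStarProjection hq hr).2 hqr
  set z := (orbitSpan B r).starProjection
  have hzBM : z ∈ relativeCommutant B M := starProjection_orbitSpan_mem_relativeCommutant hBM hrM
  have hzr : z * r = r := ContinuousLinearMap.ext fun ω =>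
    Submodule.starProjection_eq_self_iff.2 (apply_apply_mem_orbitSpan (one_mem B) ω)
  have hrz : r * z = r :=
    (mul_eq_comm_of_isStarProjection isStarProjection_starProjection hr).2 hzr
  have hqz : q * z = r := by
    rw [← hrz, ← sub_eq_zero, ← sub_mul, mul_starProjection_orbitSpan hr hqr hrq hcomm]
  exact ⟨z, hzBM, by rw [← VonNeumannAlgebra.mem_commutant_iff.1 hzBM.1 q hqB, hqz]⟩

end OrbitSpan

/-! ### Partial isometries -/

section PartialIsometry

variable {M B : VonNeumannAlgebra H} {q v : H →L[ℂ] H}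

namespace IsPartialIsometry

theorem mul_star_mul_self (hv : IsPartialIsometry v) : v * (star v * v) = v := by
  rw [← mul_assoc, hv]

theorem star_mul_self (hv : IsPartialIsometry v) : IsStarProjection (star v * v) where
  isIdempotentElem := by rw [IsIdempotentElem, mul_assoc, hv.mul_star_mul_self]
  isSelfAdjoint := IsSelfAdjoint.star_mul_self v

theorem star_mul_self_mul_star (hv : IsPartialIsometry v) :
    Star.star v * v * Star.star v = Star.star v := by
  simpa only [star_mul, star_star] using congrArg Star.star hv.mul_star_mul_self

theorem star (hv : IsPartialIsometry v) : IsPartialIsometry (Star.star v) := by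
  rw [IsPartialIsometry, star_star, hv.star_mul_self_mul_star]

theorem mul_star_self (hv : IsPartialIsometry v) : IsStarProjection (v * Star.star v) := by
  simpa only [star_star] using hv.star.star_mul_self

theorem norm_apply_le (hv : IsPartialIsometry v) (ζ : H) : ‖v ζ‖ ≤ ‖ζ‖ := by
  have := re_inner_nonneg_of_nonneg (sub_nonneg.2 hv.star_mul_self.le_one) ζ
  rw [sub_apply, inner_sub_right, Complex.sub_re, re_inner_star_mul_self_apply,
    one_apply_eq_self, sub_nonneg] at this
  exact (sq_le_sq₀ (norm_nonneg _) (norm_nonneg _)).1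
    (this.trans_eq (inner_self_eq_norm_sq (𝕜 := ℂ) ζ))

end IsPartialIsometry

theorem isPartialIsometry_of_isStarProjection (hv : IsStarProjection (star v * v)) :
    IsPartialIsometry v := by
  rw [IsPartialIsometry, ← sub_eq_zero, ← CStarRing.star_mul_self_eq_zero_iff]
  calc star (v * star v * v - v) * (v * star v * v - v)
      = star v * v * (star v * v) * (star v * v) - star v * v * (star v * v)
        - (star v * v * (star v * v) - star v * v) := by
        simp only [star_sub, star_mul, star_star, mul_sub, sub_mul, mul_assoc]
    _ = 0 := by simp only [hv.isIdempotentElem.eq, sub_self]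

theorem star_mul_self_mem_cutDown (hBM : B ≤ M)
    (hcomm : relativeCommutant B M ⊆ (B : Set (H →L[ℂ] H))) (hq : IsStarProjection q)
    (hqB : q ∈ B) (hv : IsPartialIsometry v) (hvM : v ∈ M) (hvq : v * q = v)
    (h : ∀ b ∈ B, v * (q * b * q) = v * (q * b * q) * (star v * v)) :
    star v * v ∈ cutDown (centre B) q := by
  refine cutDown_subset (relativeCommutant_subset_centre hcomm) q
    (mem_cutDown_of_commute_corner hBM hq hqB (mul_mem (star_mem hvM) hvM) hv.star_mul_self
      ((mul_eq_comm_of_isStarProjection hq hv.star_mul_self).1 (by rw [mul_assoc, hvq]))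
      fun b hb => ?_)
  have hright : ∀ b ∈ B, star v * v * (q * b * q) =
      star v * v * (q * b * q) * (star v * v) := fun b hb => by
    simpa only [mul_assoc] using congrArg (star v * ·) (h b hb)
  have hleft := congrArg star (hright _ (star_mem hb))
  simp only [star_mul, star_star, hq.isSelfAdjoint.star_eq] at hleft
  rw [Commute, SemiconjBy, hright b hb]
  simpa only [mul_assoc] using hleft

end PartialIsometry

/-! ### Projections of the form `v* e_B v` -/

section CanonicalTrace

variable {M B : VonNeumannAlgebra H} {ξ : H}

theorem le_canonicalTrace (t : H →L[ℂ] H) {V : H →L[ℂ] H} (hV : V ∈ basicConstruction M B ξ)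
    (hVp : IsPartialIsometry V) (hVe : star V * jonesProjection B ξ * V ≤ 1) :
    ENNReal.ofReal (⟪star V ξ, t (star V ξ)⟫_ℂ).re ≤ canonicalTrace M B ξ t := by
  refine le_iSup_of_le 1 (le_iSup_of_le (fun _ => V) (le_iSup_of_le ⟨fun _ => ⟨hV, hVp⟩, ?_⟩ ?_))
  · simpa only [Finset.univ_unique, Finset.sum_singleton] using hVe
  · simp only [Finset.univ_unique, Finset.sum_singleton, le_refl]

theorem sum_norm_jonesProjection_apply_le {n : ℕ} {V : Fin n → H →L[ℂ] H}
    (hV : ∑ i, star (V i) * jonesProjection B ξ * V i ≤ 1) (ζ : H) :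
    ∑ i, ‖jonesProjection B ξ (V i ζ)‖ ^ 2 ≤ ‖ζ‖ ^ 2 := by
  have hre := re_inner_nonneg_of_nonneg (sub_nonneg.2 hV) ζ
  have hnorm : ∀ i, (⟪ζ, (star (V i) * jonesProjection B ξ * V i) ζ⟫_ℂ).re =
      ‖jonesProjection B ξ (V i ζ)‖ ^ 2 := fun i => by
    rw [mul_apply_eq_comp, mul_apply_eq_comp, inner_apply_star,
      re_inner_apply_of_isStarProjection isStarProjection_jonesProjection]
  rw [sub_apply, sum_apply, inner_sub_right, inner_sum, Complex.sub_re, Complex.re_sum,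
    one_apply_eq_self, sub_nonneg] at hre
  simp only [hnorm] at hre
  exact hre.trans_eq (inner_self_eq_norm_sq (𝕜 := ℂ) ζ)

theorem IsStandardForm.canonicalTrace_star_mul_jonesProjection_mul_le (hM : IsStandardForm M ξ)
    (hBM : B ≤ M) {w : H →L[ℂ] H} (hw : w ∈ M) :
    canonicalTrace M B ξ (star w * jonesProjection B ξ * w) ≤ ENNReal.ofReal (‖w ξ‖ ^ 2) := by
  refine iSup_le fun n => iSup_le fun V => iSup_le fun ⟨hV, hsum⟩ => ?_
  have hterm : ∀ i, (⟪star (V i) ξ, (star w * jonesProjection B ξ * w) (star (V i) ξ)⟫_ℂ).re =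
      ‖jonesProjection B ξ (V i (star w ξ))‖ ^ 2 := fun i => by
    have hVw := hM.isRightModular_of_mem_basicConstruction hBM
      (mul_mem (hV i).1 (mem_basicConstruction (star_mem hw)))
    have := hM.norm_jonesProjection_star_apply hBM hVw
    rw [star_mul, star_star, mul_apply_eq_comp, mul_apply_eq_comp] at this
    rw [mul_apply_eq_comp, mul_apply_eq_comp, inner_apply_star,
      re_inner_apply_of_isStarProjection isStarProjection_jonesProjection, this]
  simp only [hterm]
  rw [← ENNReal.ofReal_sum_of_nonneg fun i _ => sq_nonneg _, ← hM.norm_star_apply hw]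
  exact ENNReal.ofReal_le_ofReal (sum_norm_jonesProjection_apply_le hsum _)

end CanonicalTrace

theorem subequivalent_of_eq {M B : VonNeumannAlgebra H} {ξ : H} {P v : H →L[ℂ] H} (hvM : v ∈ M)
    (hv : IsPartialIsometry v) (hPv : P = star v * jonesProjection B ξ * v) :
    Subequivalent (basicConstruction M B ξ) P (jonesProjection B ξ) := by
  refine ⟨jonesProjection B ξ * v,
    mul_mem jonesProjection_mem_basicConstruction (mem_basicConstruction hvM), ?_, ?_⟩
  · rw [hPv, star_mul, star_jonesProjection, mul_assoc, ← mul_assoc _ _ v,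
      jonesProjection_mul_self, mul_assoc]
  · have := star_right_conjugate_le_conjugate hv.mul_star_self.le_one (jonesProjection B ξ)
    rw [star_jonesProjection, mul_one, jonesProjection_mul_self] at this
    rw [star_mul, star_jonesProjection]
    simpa only [mul_assoc] using this

namespace IsStandardForm

variable {M B : VonNeumannAlgebra H} {ξ : H} (hM : IsStandardForm M ξ)
  {q P v : H →L[ℂ] H}
include hM

theorem canonicalTrace_mul_le (hBM : B ≤ M) (hq : IsStarProjection q) (hqB : q ∈ B)
    (hPq : P ∈ cutDown (relativeCommutant B (basicConstruction M B ξ)) q)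
    (hvM : v ∈ M) (hv : IsPartialIsometry v) (hPv : P = star v * jonesProjection B ξ * v)
    {r : H →L[ℂ] H} (hrq : r ∈ cutDown (centre B) q) (hr : IsStarProjection r) :
    canonicalTrace M B ξ (P * r) ≤ ENNReal.ofReal (vectorTrace ξ (q * r)).re := by
  have hrqr : r * q = r := mul_eq_of_mem_cutDown hq hrq
  have hqr : q * r = r := (mul_eq_comm_of_isStarProjection hq hr).1 hrqr
  have hrB : r ∈ B := by
    obtain ⟨z, hz, rfl⟩ := hrq
    exact mul_mem hz.2 hqB
  have hrP : r * P = P * r := (commute_of_mem_cutDown hPq hrB (hrqr.trans hqr.symm)).eq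
  have hPr : P * r = star (v * r) * jonesProjection B ξ * (v * r) := calc
    P * r = r * P * r := by rw [hrP, mul_assoc, hr.isIdempotentElem.eq]
    _ = star (v * r) * jonesProjection B ξ * (v * r) := by
      simp only [hPv, star_mul, hr.isSelfAdjoint.star_eq, mul_assoc]
  rw [hPr, hqr, vectorTrace, re_inner_apply_of_isStarProjection hr]
  refine (hM.canonicalTrace_star_mul_jonesProjection_mul_le hBM (mul_mem hvM (hBM hrB))).trans ?_
  gcongr
  exact hv.norm_apply_le (r ξ)

theorem mul_eq_of_star_mul_jonesProjection_mul_eq (hq : IsStarProjection q) (hqM : q ∈ M)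
    (hP : IsStarProjection P) (hPq : P * q = P) (hvM : v ∈ M)
    (hPv : P = star v * jonesProjection B ξ * v) : v * q = v := by
  set e := jonesProjection B ξ
  refine hM.eq_of_jonesProjection_mul (B := B) (mul_mem hvM hqM) hvM ?_
  rw [← sub_eq_zero, ← CStarRing.star_mul_self_eq_zero_iff]
  calc star (e * (v * q) - e * v) * (e * (v * q) - e * v)
      = q * (star v * (e * e) * v) * q - q * (star v * (e * e) * v)
        - (star v * (e * e) * v * q - star v * (e * e) * v) := by
        simp only [star_sub, star_mul, star_jonesProjection, e, hq.isSelfAdjoint.star_eq, mul_sub,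
          sub_mul, mul_assoc]
        abel
    _ = 0 := by
        rw [jonesProjection_mul_self, ← hPv, (mul_eq_comm_of_isStarProjection hq hP).1 hPq, hPq,
          sub_self]

theorem mul_eq_mul_star_mul_self_of_commute (hBM : B ≤ M) (hv : v ∈ intertwiners M B)
    {a : H →L[ℂ] H} (ha : a ∈ B) (h : Commute a (star v * jonesProjection B ξ * v)) :
    v * a = v * a * (star v * v) := by
  obtain ⟨hvM, hvp, hvB, -⟩ := hv
  set e := jonesProjection B ξ
  have hvv : e * (v * star v) = v * star v * e :=
    jonesProjection_mul (by simpa only [mul_one] using hvB 1 (one_mem B))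
  have hvav : e * (v * a * star v) = v * a * star v * e := jonesProjection_mul (hvB a ha)
  refine hM.eq_of_jonesProjection_mul (B := B) (mul_mem hvM (hBM ha))
    (mul_mem (mul_mem hvM (hBM ha)) (mul_mem (star_mem hvM) hvM)) ?_
  calc e * (v * a) = e * (v * star v) * v * a := by rw [mul_assoc e _ v, hvp, mul_assoc]
    _ = v * (star v * e * v * a) := by rw [hvv]; simp only [mul_assoc]
    _ = v * (a * (star v * e * v)) := by rw [h.eq]
    _ = v * a * star v * e * v := by simp only [mul_assoc]
    _ = e * (v * a * (star v * v)) := by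
      rw [← hvav]
      simp only [mul_assoc]

theorem star_mul_self_mem_cutDown_of_mem_intertwiners (hBM : B ≤ M)
    (hcomm : relativeCommutant B M ⊆ (B : Set (H →L[ℂ] H))) (hq : IsStarProjection q)
    (hqB : q ∈ B) (hP : IsStarProjection P)
    (hPq : P ∈ cutDown (relativeCommutant B (basicConstruction M B ξ)) q)
    (hv : v ∈ intertwiners M B) (hPv : P = star v * jonesProjection B ξ * v) :
    star v * v ∈ cutDown (centre B) q := by
  have hvq : v * q = v := hM.mul_eq_of_star_mul_jonesProjection_mul_eq hq (hBM hqB) hP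
    (mul_eq_of_mem_cutDown hq hPq) hv.1 hPv
  refine star_mul_self_mem_cutDown hBM hcomm hq hqB hv.2.1 hv.1 hvq fun b hb => ?_
  have hbB : q * b * q ∈ B := mul_mem (mul_mem hqB hb) hqB
  exact hM.mul_eq_mul_star_mul_self_of_commute hBM hv hbB
    (hPv ▸ commute_of_mem_cutDown hPq hbB (commute_corner hq b))

end IsStandardForm

/-! ### Operators below the Jones projection -/

theorem norm_apply_star_apply_le {M B : VonNeumannAlgebra H} {ξ : H} {V : H →L[ℂ] H}
    (hV : V ∈ basicConstruction M B ξ) (heV : jonesProjection B ξ * V = V)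
    (hVp : IsPartialIsometry V) {r : H →L[ℂ] H} (hr : IsStarProjection r)
    (hcomm : Commute r (star V * V))
    (htr : canonicalTrace M B ξ (star V * V * r) ≤ ENNReal.ofReal (vectorTrace ξ r).re) :
    ‖r (star V ξ)‖ ≤ ‖r ξ‖ := by
  have hVe : star V * jonesProjection B ξ * V ≤ 1 := by
    rw [mul_assoc, heV]
    exact hVp.star_mul_self.le_one
  have hle := (le_canonicalTrace (star V * V * r) hV hVp hVe).trans htr
  have hPr : (star V * V * r) (star V ξ) = r (star V ξ) := by
    rw [← hcomm.eq, mul_apply_eq_comp, ← mul_apply_eq_comp _ (star V),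
      hVp.star_mul_self_mul_star]
  rw [hPr, vectorTrace, re_inner_apply_of_isStarProjection hr,
    re_inner_apply_of_isStarProjection hr, ENNReal.ofReal_le_ofReal_iff (sq_nonneg _)] at hle
  exact (sq_le_sq₀ (norm_nonneg _) (norm_nonneg _)).1 hle

namespace IsStandardForm

variable {M B : VonNeumannAlgebra H} {ξ : H} (hM : IsStandardForm M ξ) {q P V y : H →L[ℂ] H}
include hM

theorem mem_vectorCentralizer_star_apply (hBM : B ≤ M) (hV : IsRightModular M B ξ V)
    (heV : jonesProjection B ξ * V = V) (hVp : IsPartialIsometry V) {d : H →L[ℂ] H} (hd : d ∈ M)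
    (hcomm : Commute d (star V * V)) : d ∈ vectorCentralizer M (star V ξ) := by
  have hcorner : ∀ m ∈ M, IsJonesCorner M B ξ (V * m * star V) := fun m hm => by
    have hVe : star V * jonesProjection B ξ = star V := by
      simpa only [star_mul, star_jonesProjection] using congrArg star heV
    have := hM.isJonesCorner_compression hBM
      ((hV.mul (hM.isRightModular_of_mem hBM hm)).mul (hM.isRightModular_star hV))
    rwa [mul_assoc, mul_assoc _ (star V), hVe, mul_assoc V, ← mul_assoc, heV, ← mul_assoc] at this
  have htrace : ∀ S, vectorTrace (star V ξ) S = vectorTrace ξ (V * S * star V) := fun S => by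
    rw [vectorTrace, inner_star_apply]
    rfl
  refine ⟨hd, fun m hm => ?_⟩
  have hdm : V * (d * m) * star V = V * d * star V * (V * m * star V) := calc
    V * (d * m) * star V = V * (star V * V) * d * m * star V := by
      rw [hVp.mul_star_mul_self, mul_assoc V d]
    _ = V * (d * (star V * V)) * m * star V := by rw [hcomm.eq]; simp only [mul_assoc]
    _ = V * d * star V * (V * m * star V) := by simp only [mul_assoc]
  have hmd : V * (m * d) * star V = V * m * star V * (V * d * star V) := calc
    V * (m * d) * star V = V * m * d * (star V * V * star V) := by
      rw [hVp.star_mul_self_mul_star, mul_assoc V m]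
    _ = V * m * (d * (star V * V)) * star V := by simp only [mul_assoc]
    _ = V * m * star V * (V * d * star V) := by rw [hcomm.eq]; simp only [mul_assoc]
  rw [htrace, htrace, hdm, hmd,
    hM.vectorTrace_mul_comm_of_isJonesCorner hBM (hcorner d hd) (hcorner m hm)]

theorem exists_isStarProjection_mul_eq (hBM : B ≤ M) (hy : y ∈ M)
    (hey : IsPartialIsometry (jonesProjection B ξ * star y)) :
    ∃ p ∈ B, IsStarProjection p ∧ y * p = y ∧
      jonesProjection B ξ * (star y * y) * jonesProjection B ξ = p * jonesProjection B ξ := by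
  obtain ⟨p, hpB, hp⟩ := hM.exists_eq_mul_jonesProjection hBM (hM.isJonesCorner_compression hBM
    (hM.isRightModular_of_mem hBM (mul_mem (star_mem hy) hy)))
  have hep : jonesProjection B ξ * p = p * jonesProjection B ξ := jonesProjection_mul hpB
  have heps := jonesProjection_mul (ξ := ξ) (star_mem hpB)
  have hees := star_jonesProjection (B := B) (ξ := ξ)
  have hee := jonesProjection_mul_self (B := B) (ξ := ξ)
  generalize he : jonesProjection B ξ = e at hep heps hee hees hey hp ⊢
  have hp' : e * star y * star (e * star y) = p * e := by
    rw [star_mul, star_star, hees, ← hp]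
    simp only [mul_assoc]
  have hpe : IsStarProjection (p * e) := hp' ▸ hey.mul_star_self
  have hps : star p = p := by
    refine hM.eq_of_mul_jonesProjection (B := B) (star_mem (hBM hpB)) (hBM hpB) ?_
    rw [he, ← heps, ← hpe.isSelfAdjoint.star_eq, star_mul, hees]
  have hpp : p * p = p := by
    refine hM.eq_of_mul_jonesProjection (B := B) (mul_mem (hBM hpB) (hBM hpB)) (hBM hpB) ?_
    calc p * p * jonesProjection B ξ = p * (p * e) * e := by
          rw [he, mul_assoc p (p * e), mul_assoc p e, hee, mul_assoc]
      _ = p * e * (p * e) := by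
          rw [mul_assoc p e, ← mul_assoc e p, hep, mul_assoc p (p * e)]
      _ = p * jonesProjection B ξ := by rw [hpe.isIdempotentElem.eq, he]
  have hpy : p * star y = star y := by
    refine hM.eq_of_jonesProjection_mul (B := B) (mul_mem (hBM hpB) (star_mem hy)) (star_mem hy) ?_
    calc jonesProjection B ξ * (p * star y) = p * e * (e * star y) := by
          rw [he, ← mul_assoc, hep, mul_assoc p e (e * star y), ← mul_assoc e e, hee, mul_assoc]
      _ = e * star y * star (e * star y) * (e * star y) := by rw [hp']
      _ = jonesProjection B ξ * star y := by rw [hey, he]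
  refine ⟨p, hpB, ⟨hpp, hps⟩, ?_, hp⟩
  simpa only [star_mul, star_star, hps] using congrArg star hpy

theorem isStarProjection_star_mul_self (hBM : B ≤ M) (hy : y ∈ M) (hy1 : ‖y‖ ≤ 1)
    (hey : IsPartialIsometry (jonesProjection B ξ * star y)) :
    IsStarProjection (star y * y) ∧ star y * y ∈ B := by
  obtain ⟨p, hpB, hp, hyp, hpe⟩ := hM.exists_isStarProjection_mul_eq hBM hy hey
  have hyy1 : star y * y ≤ 1 := by
    rw [← CStarAlgebra.norm_le_one_iff_of_nonneg _ (star_mul_self_nonneg y),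
      CStarRing.norm_star_mul_self]
    exact mul_le_one₀ hy1 (norm_nonneg y) hy1
  have hle : star y * y ≤ p := by
    have := star_left_conjugate_le_conjugate hyy1 p
    rwa [mul_one, ← mul_assoc, ← star_mul, mul_assoc, hyp, hp.isSelfAdjoint.star_eq,
      hp.isIdempotentElem.eq] at this
  have htrace : ⟪ξ, (star y * y) ξ⟫_ℂ = ⟪ξ, p ξ⟫_ℂ := by
    have heξ : ∀ ζ, ⟪ξ, jonesProjection B ξ ζ⟫_ℂ = ⟪ξ, ζ⟫_ℂ := fun ζ => by
      rw [← star_jonesProjection, inner_apply_star, jonesProjection_self]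
    have := congrArg (fun T : H →L[ℂ] H => ⟪ξ, T ξ⟫_ℂ) hpe
    simpa only [mul_apply_eq_comp, jonesProjection_self, heξ] using this
  have hyy : p = star y * y := by
    refine sub_eq_zero.1 (hM.eq_zero_of_apply (sub_mem (hBM hpB) (mul_mem (star_mem hy) hy))
      (apply_eq_zero_of_re_inner_eq_zero (sub_nonneg.2 hle) ?_))
    rw [sub_apply, inner_sub_right, htrace, sub_self, Complex.zero_re]
  exact hyy ▸ ⟨hp, hpB⟩

theorem exists_mem_mul_eq_mul (hBM : B ≤ M) (hy : y ∈ M) (hyp : IsPartialIsometry y)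
    (hyB : star y * y ∈ B) {d : H →L[ℂ] H} (hd : d ∈ M)
    (hcomm : Commute d (y * jonesProjection B ξ * star y)) : ∃ c ∈ B, d * y = y * c := by
  obtain ⟨c, hcB, hc⟩ := hM.exists_eq_mul_jonesProjection hBM (hM.isJonesCorner_compression hBM
    (hM.isRightModular_of_mem hBM (mul_mem (mul_mem (star_mem hy) hd) hy)))
  refine ⟨c, hcB, hM.eq_of_mul_jonesProjection (B := B) (mul_mem hd hy)
    (mul_mem hy (hBM hcB)) ?_⟩
  have hye := jonesProjection_mul (ξ := ξ) hyB
  have hee := jonesProjection_mul_self (B := B) (ξ := ξ)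
  set e := jonesProjection B ξ
  calc d * y * e = d * (y * (star y * y) * (e * e)) := by
        rw [hyp.mul_star_mul_self, hee, mul_assoc]
    _ = d * (y * (star y * y * e) * e) := by simp only [mul_assoc]
    _ = d * (y * e * star y) * (y * e) := by rw [← hye]; simp only [mul_assoc]
    _ = y * (e * (star y * d * y) * e) := by rw [hcomm.eq]; simp only [mul_assoc]
    _ = y * c * e := by rw [hc, mul_assoc]

theorem exists_norm_le_one_star_eq_mul_jonesProjection (hBM : B ≤ M)
    (hcomm : relativeCommutant B M ⊆ (B : Set (H →L[ℂ] H))) (hq : IsStarProjection q)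
    (hqB : q ∈ B) (hPq : star V * V ∈ cutDown (relativeCommutant B (basicConstruction M B ξ)) q)
    (hV : V ∈ basicConstruction M B ξ) (heV : jonesProjection B ξ * V = V)
    (hVp : IsPartialIsometry V)
    (htr : ∀ r ∈ cutDown (centre B) q, IsStarProjection r →
      canonicalTrace M B ξ (star V * V * r) ≤ ENNReal.ofReal (vectorTrace ξ (q * r)).re) :
    ∃ y ∈ M, ‖y‖ ≤ 1 ∧ star V = y * jonesProjection B ξ := by
  have hVmod := hM.isRightModular_of_mem_basicConstruction hBM hV
  have hVe : star V * jonesProjection B ξ = star V := by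
    simpa only [star_mul, star_jonesProjection] using congrArg star heV
  have hqV : q * star V = star V := by
    rw [← hVp.star_mul_self_mul_star, ← mul_assoc,
      (mul_eq_comm_of_isStarProjection hq hVp.star_mul_self).1 (mul_eq_of_mem_cutDown hq hPq)]
  have hproj : ∀ r ∈ M, IsStarProjection r → q * r = r →
      (∀ d ∈ vectorCentralizer M (star V ξ), Commute d q → Commute d r) →
      ‖r (star V ξ)‖ ≤ ‖r ξ‖ := fun r hrM hr hqr hcent => by
    have hrq : r * q = r := (mul_eq_comm_of_isStarProjection hq hr).2 hqr
    have hrcut : r ∈ cutDown (centre B) q := by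
      refine cutDown_subset (relativeCommutant_subset_centre hcomm) q
        (mem_cutDown_of_commute_corner hBM hq hqB hrM hr hqr fun b hb => ?_)
      have hbB : q * b * q ∈ B := mul_mem (mul_mem hqB hb) hqB
      exact hcent _ (hM.mem_vectorCentralizer_star_apply hBM hVmod heV hVp (hBM hbB)
        (commute_of_mem_cutDown hPq hbB (commute_corner hq b))) (commute_corner hq b)
    have hrB : r ∈ B := by
      obtain ⟨z, hz, rfl⟩ := hrcut
      exact mul_mem hz.2 hqB
    have htrr := htr r hrcut hr
    rw [hqr] at htrr
    exact norm_apply_star_apply_le hV heV hVp hr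
      (commute_of_mem_cutDown hPq hrB (hrq.trans hqr.symm)) htrr
  have hqη : q (star V ξ) = star V ξ := by rw [← mul_apply_eq_comp, hqV]
  obtain ⟨y, hy, hyξ, hy1⟩ := exists_mem_apply_eq_of_norm_le hM.dense_commutant fun x hx =>
    (hM.norm_apply_le_of_forall_projection hq (hBM hqB) hqη hproj hx).trans_eq (one_mul _).symm
  exact ⟨y, hy, y.opNorm_le_bound zero_le_one hy1,
    hM.eq_mul_jonesProjection_of_apply hBM (hM.isRightModular_star hVmod) hVe hy hyξ.symm⟩

theorem star_mem_intertwiners (hBM : B ≤ M)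
    (hcomm : relativeCommutant B M ⊆ (B : Set (H →L[ℂ] H))) (hq : IsStarProjection q)
    (hqB : q ∈ B)
    (hPq : y * jonesProjection B ξ * star y ∈
      cutDown (relativeCommutant B (basicConstruction M B ξ)) q)
    (hy : y ∈ M) (hyp : IsPartialIsometry y) (hyB : star y * y ∈ B) (hqy : q * y = y) :
    star y ∈ intertwiners M B := by
  have hyq : star y * q = star y := by
    simpa only [star_mul, hq.isSelfAdjoint.star_eq] using congrArg star hqy
  have hcorner : ∀ b ∈ B, ∃ c ∈ B, q * b * q * y = y * c := fun b hb =>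
    have hbB : q * b * q ∈ B := mul_mem (mul_mem hqB hb) hqB
    hM.exists_mem_mul_eq_mul hBM hy hyp hyB (hBM hbB)
      (commute_of_mem_cutDown hPq hbB (commute_corner hq b))
  have hright : ∀ b ∈ B, star y * (q * b * q) = star y * (q * b * q) * (y * star y) :=
    fun b hb => by
      obtain ⟨c, -, hc⟩ := hcorner (star b) (star_mem hb)
      have hleft : q * star b * q * y = y * star y * (q * star b * q * y) := by
        rw [hc, ← mul_assoc, hyp]
      simpa only [star_mul, star_star, hq.isSelfAdjoint.star_eq, mul_assoc] using
        congrArg star hleft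
  refine ⟨star_mem hy, hyp.star, fun b hb => ?_, ?_⟩
  · obtain ⟨c, hcB, hc⟩ := hcorner b hb
    have hbc : star y * b * star (star y) = star y * y * c := by
      rw [star_star, mul_assoc _ y, ← hc, ← mul_assoc, ← mul_assoc, ← mul_assoc, hyq, mul_assoc _ q,
        hqy]
    exact hbc ▸ mul_mem hyB hcB
  · obtain ⟨z, hz, hyz⟩ := star_mul_self_mem_cutDown hBM hcomm hq hqB hyp.star (star_mem hy) hyq
      (by simpa only [star_star] using hright)
    exact hyz ▸ mul_mem hz.2 hqB

theorem exists_intertwiner (hBM : B ≤ M)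
    (hcomm : relativeCommutant B M ⊆ (B : Set (H →L[ℂ] H))) (hq : IsStarProjection q)
    (hqB : q ∈ B) (hP : IsStarProjection P)
    (hPq : P ∈ cutDown (relativeCommutant B (basicConstruction M B ξ)) q)
    (hsub : Subequivalent (basicConstruction M B ξ) P (jonesProjection B ξ))
    (htr : ∀ r ∈ cutDown (centre B) q, IsStarProjection r →
      canonicalTrace M B ξ (P * r) ≤ ENNReal.ofReal (vectorTrace ξ (q * r)).re) :
    ∃ v ∈ intertwiners M B, P = star v * jonesProjection B ξ * v := by
  obtain ⟨V, hV, rfl, hVe⟩ := hsub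
  have hVp : IsPartialIsometry V := isPartialIsometry_of_isStarProjection hP
  have heV : jonesProjection B ξ * V = V := by
    have := (hVp.mul_star_self.le_iff_mul_eq_right isStarProjection_jonesProjection).1 hVe
    rw [← hVp, ← mul_assoc, this]
  obtain ⟨y, hy, hy1, hyV⟩ :=
    hM.exists_norm_le_one_star_eq_mul_jonesProjection hBM hcomm hq hqB hPq hV heV hVp htr
  have hVy : V = jonesProjection B ξ * star y := by
    simpa only [star_mul, star_star, star_jonesProjection] using congrArg star hyV
  have hPy : star V * V = y * jonesProjection B ξ * star y := by
    rw [hVy, star_mul, star_star, star_jonesProjection, mul_assoc, ← mul_assoc _ _ (star y),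
      jonesProjection_mul_self, mul_assoc]
  obtain ⟨hyp, hyB⟩ := hM.isStarProjection_star_mul_self hBM hy hy1 (hVy ▸ hVp)
  have hqy : q * y = y := by
    have hyq : star y * q = star y :=
      hM.mul_eq_of_star_mul_jonesProjection_mul_eq hq (hBM hqB) hP (mul_eq_of_mem_cutDown hq hPq)
        (star_mem hy) (by rw [star_star, hPy])
    simpa only [star_mul, star_star, hq.isSelfAdjoint.star_eq] using congrArg star hyq
  exact ⟨star y, hM.star_mem_intertwiners hBM hcomm hq hqB (hPy ▸ hPq) hy
    (isPartialIsometry_of_isStarProjection hyp) hyB hqy, by rw [star_star, hPy]⟩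

end IsStandardForm

end FiniteInclusion

end

open FiniteInclusion in
theorem mainTheorem5_general {H : Type*} [NormedAddCommGroup H] [InnerProductSpace ℂ H]
    [CompleteSpace H] (M B : VonNeumannAlgebra H) (ξ : H) (hM : IsStandardForm M ξ) (hBM : B ≤ M)
    (hcomm : relativeCommutant B M ⊆ (B : Set (H →L[ℂ] H)))
    (q : H →L[ℂ] H) (hqB : q ∈ B) (hq : IsStarProjection q)
    (P : H →L[ℂ] H) (hP : IsStarProjection P)
    (hPq : P ∈ cutDown (relativeCommutant B (basicConstruction M B ξ)) q) :
    ((∃ v ∈ intertwiners M B, P = star v * jonesProjection B ξ * v) ↔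
      Subequivalent (basicConstruction M B ξ) P (jonesProjection B ξ) ∧
        ∀ r ∈ cutDown (centre B) q, IsStarProjection r →
          canonicalTrace M B ξ (P * r) ≤ ENNReal.ofReal (vectorTrace ξ (q * r)).re) ∧
    (∀ v ∈ intertwiners M B, P = star v * jonesProjection B ξ * v →
      star v * v ∈ cutDown (centre B) q) := by
  refine ⟨⟨?_, fun ⟨hsub, htr⟩ => hM.exists_intertwiner hBM hcomm hq hqB hP hPq hsub htr⟩,
    fun v hv hPv =>
      hM.star_mul_self_mem_cutDown_of_mem_intertwiners hBM hcomm hq hqB hP hPq hv hPv⟩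
  rintro ⟨v, hv, hPv⟩
  exact ⟨subequivalent_of_eq hv.1 hv.2.1 hPv, fun r hrq hr =>
    hM.canonicalTrace_mul_le hBM hq hqB hPq hv.1 hv.2.1 hPv hrq hr⟩

theorem mainTheorem5 {H : Type*} [NormedAddCommGroup H] [InnerProductSpace ℂ H]
    [CompleteSpace H] [TopologicalSpace.SeparableSpace H]
    (M B : VonNeumannAlgebra H) (ξ : H)
    (hM : FiniteInclusion.IsStandardForm M ξ) (hBM : B ≤ M)
    (hcomm : FiniteInclusion.relativeCommutant B M ⊆ (B : Set (H →L[ℂ] H)))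
    (q : H →L[ℂ] H) (hqB : q ∈ B) (hq : IsStarProjection q)
    (P : H →L[ℂ] H) (hP : IsStarProjection P)
    (hPq : P ∈ FiniteInclusion.cutDown
      (FiniteInclusion.relativeCommutant B (FiniteInclusion.basicConstruction M B ξ)) q) :
    ((∃ v ∈ FiniteInclusion.intertwiners M B,
        P = star v * FiniteInclusion.jonesProjection B ξ * v) ↔
      FiniteInclusion.Subequivalent (FiniteInclusion.basicConstruction M B ξ) P
          (FiniteInclusion.jonesProjection B ξ) ∧
        ∀ r ∈ FiniteInclusion.cutDown (FiniteInclusion.centre B) q, IsStarProjection r →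
          FiniteInclusion.canonicalTrace M B ξ (P * r) ≤
            ENNReal.ofReal (FiniteInclusion.vectorTrace ξ (q * r)).re) ∧
    (∀ v ∈ FiniteInclusion.intertwiners M B,
      P = star v * FiniteInclusion.jonesProjection B ξ * v →
        star v * v ∈ FiniteInclusion.cutDown (FiniteInclusion.centre B) q) :=
  mainTheorem5_general M B ξ hM hBM hcomm q hqB hq P hP hPq
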